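/- Let $k$ be a field of characteristic zero, let $r,t_1,s_1,t_2,s_2\ge 0$ be integers and let $c_1,c_2\in k$. Assume that $t_2\le t_1$ and $(t_1,s_1)\ne(t_2,s_2)$. Let $d$ be the $k$-derivation $$d=y^r\,\partial_x+\bigl(c_1x^{t_1}y^{s_1}+c_2x^{t_2}y^{s_2}\bigr)\,\partial_y$$ of the polynomial ring $k[x,y]$. Call $d$ simple if $\{0\}$ and $k[x,y]$ are the only ideals $I$ of $k[x,y]$ with $d(I)\subseteq I$. Then $d$ is simple if and only if all of the following conditions hold: (a) $c_1\neq 0$, $c_2\neq 0$ and $t_2<t_1$; (b) if $r>0$, then $t_2=s_2=0$ and $s_1>0$; (c) if $r=0$, then $s_1+s_2>0$ and $s_1s_2=0$; (d) if $r=s_1=0$ and $s_2=1$, then $(t_2+1)\nmid(t_1-t_2)$. -/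

import Mathlib

/-- An ideal `I` of `A` is `d`-differential if `d(I) ⊆ I`. -/
def IsDifferentialIdeal {k A : Type*} [CommRing k] [CommRing A] [Algebra k A]
    (d : Derivation k A A) (I : Ideal A) : Prop :=
  ∀ a ∈ I, d a ∈ I

/-- A derivation `d` of `A` is simple if `{0}` and `A` are the only `d`-differential ideals. -/
def IsSimpleDerivation {k A : Type*} [CommRing k] [CommRing A] [Algebra k A]
    (d : Derivation k A A) : Prop :=
  ∀ I : Ideal A, IsDifferentialIdeal d I ↔ I = ⊥ ∨ I = ⊤

/-- The `k`-derivation `y^r ∂ₓ + (c₁ x^t₁ y^s₁ + c₂ x^t₂ y^s₂) ∂ᵧ` of `k[x, y]`,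
with `x = X 0` and `y = X 1`. -/
noncomputable def binomialDerivation {k : Type*} [Field k] (r t₁ s₁ t₂ s₂ : ℕ) (c₁ c₂ : k) :
    Derivation k (MvPolynomial (Fin 2) k) (MvPolynomial (Fin 2) k) :=
  (MvPolynomial.X 1 ^ r : MvPolynomial (Fin 2) k) • MvPolynomial.pderiv 0 +
    (MvPolynomial.C c₁ * MvPolynomial.X 0 ^ t₁ * MvPolynomial.X 1 ^ s₁ +
      MvPolynomial.C c₂ * MvPolynomial.X 0 ^ t₂ * MvPolynomial.X 1 ^ s₂ :
        MvPolynomial (Fin 2) k) • MvPolynomial.pderiv 1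

/-! Necessity is by exhibiting an invariant ideal whenever a condition fails: it is generated by
`y`, by a polynomial first integral (when neither monomial with nonzero coefficient involves `y`),
by the common `y`-factor of the two monomials, or by `y - p(x)` with `p` a polynomial solution of a
linear equation, or it is the maximal ideal of a singular origin.

For sufficiency, write the binomial as `g = A x^α y^s + B x^β` with `s > 0`: conditions (b) and (c)
leave exactly one monomial containing `y`. The core is that every Darboux polynomial, that is, every
nonzero `f` with `f ∣ d f`, is a unit. Put `t = 1/x` and split `f`, as a polynomial in `y`, over
Puiseux series in `t`. Each root satisfies `z^r z' = A x^α z^s + B x^β`, and logarithmic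
differentiation writes the cofactor `d f / f` as `y^r c'/c` plus the sum of the quotients `(g - z'
y^r)/(y - z)`, where `c` is the leading coefficient of `f`. The coefficients of the cofactor are
polynomials in `x`, so they have no `x⁻¹` term. The `x⁻¹` coefficient of each root's contribution is
a rational number, found by balancing leading terms in the differential equation.

If `r < s`, the coefficient of `y^r` gives a linear relation between `deg c` and the number of roots
(`natDegree_relations_of_dvd_planarDeriv`). Comparison with the order of `f(x, 0)`, or positivity,
then leaves no roots. If `s ≤ r`, the lower coefficients show that sums of negative powers of the
roots are polynomials in `x`, and one of them times `A x^α` would have a positive `x⁻¹` coefficient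
(`natDegree_eq_zero_of_dvd_planarDeriv_of_le`). The case `r = 0`, `s = 1`, `α < β` escapes the
residue argument: there a Darboux polynomial of positive `y`-degree yields a polynomial solution of
`p' = A x^α p + B' x^β`, which condition (d) excludes.

Finally, the primitive part of an element of least `y`-degree in a nonzero invariant ideal is a
Darboux polynomial, hence a unit, so the ideal meets `k[x]` nontrivially. Repeated differentiation
then produces `1`. -/

section PlanarDerivations

open Polynomial

/-! ### Factorisation over power series from Weierstrass preparation. -/

section Puiseux

/-- A polynomial over a complete local ring whose reduction has order of vanishing `m` at the
origin is divisible by a monic polynomial of degree `m`. -/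
theorem exists_monic_dvd_of_coeff_mem_maximalIdeal {A : Type*} [CommRing A] [IsLocalRing A]
    [IsAdicComplete (IsLocalRing.maximalIdeal A) A] (P : A[X]) (m : ℕ)
    (hlt : ∀ i < m, P.coeff i ∈ IsLocalRing.maximalIdeal A)
    (hm : P.coeff m ∉ IsLocalRing.maximalIdeal A) :
    ∃ G : A[X], G.Monic ∧ G.natDegree = m ∧ G ∣ P := by
  have hord : ((P : PowerSeries A).map (IsLocalRing.residue A)).order = m := by
    rw [PowerSeries.order_eq_nat]
    refine ⟨?_, fun i hi => ?_⟩
    · simpa [IsLocalRing.residue_eq_zero_iff] using hm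
    · simpa [IsLocalRing.residue_eq_zero_iff] using hlt i hi
  have hne : (P : PowerSeries A).map (IsLocalRing.residue A) ≠ 0 := by
    intro h
    rw [h, PowerSeries.order_zero] at hord
    exact absurd hord (by simp)
  obtain ⟨G, U, H⟩ := PowerSeries.exists_isWeierstrassFactorization hne
  have hG : G.Monic := H.isDistinguishedAt.monic
  have hdeg : G.natDegree = m := by
    rw [H.natDegree_eq_toNat_order_map, hord]; rfl
  refine ⟨G, hG, hdeg, ?_⟩
  have hGo : ((G : PowerSeries A).map (Ideal.Quotient.mk (IsLocalRing.maximalIdeal A))).order.toNat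
      = m := by
    have := H.isDistinguishedAt.coe_natDegree_eq_order_map (G : PowerSeries A) 1
      (by rw [map_one]; exact fun h =>
        (Ideal.ne_top_iff_one _).1 (Ideal.IsMaximal.ne_top inferInstance) h)
      (by simp)
    rw [← this, hdeg]; rfl
  -- Both `G * U + 0` and `G * (P /ₘ G) + P %ₘ G` are Weierstrass divisions of `P` by `G`.
  -- Uniqueness kills the remainder, so `G` divides `P` already among polynomials.
  have hdiv := (H.isDistinguishedAt.isWeierstrassDivisorAt'
    (I := IsLocalRing.maximalIdeal A)).eq_of_mul_add_eq_mul_add (q := U) (r := 0)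
    (q' := ((P /ₘ G : A[X]) : PowerSeries A)) (r' := P %ₘ G)
    (by rw [Polynomial.degree_zero]; exact WithBot.bot_lt_coe _)
    (by rw [hGo, ← hdeg, ← Polynomial.degree_eq_natDegree hG.ne_zero]
        exact Polynomial.degree_modByMonic_lt _ hG)
    (by
      rw [← Polynomial.coe_mul, ← Polynomial.coe_add, add_comm (G * _),
        Polynomial.modByMonic_add_div P G]
      simpa using H.eq_mul.symm)
  exact (Polynomial.modByMonic_eq_zero_iff_dvd hG).1 hdiv.2.symm

instance instIsAdicCompletePowerSeries (F : Type*) [Field F] :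
    IsAdicComplete (IsLocalRing.maximalIdeal (PowerSeries F)) (PowerSeries F) := by
  rw [PowerSeries.maximalIdeal_eq_span_X]; infer_instance

theorem PowerSeries.mem_maximalIdeal_iff_constantCoeff {F : Type*} [Field F] (a : PowerSeries F) :
    a ∈ IsLocalRing.maximalIdeal (PowerSeries F) ↔ PowerSeries.constantCoeff a = 0 := by
  rw [PowerSeries.maximalIdeal_eq_span_X, Ideal.mem_span_singleton, PowerSeries.X_dvd_iff]

/-- A monic polynomial over `F⟦X⟧` with reduction different from a power of a linear polynomial
has a proper factor. -/
theorem exists_proper_monic_dvd_of_coeff {F : Type*} [Field F] [IsAlgClosed F] [CharZero F]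
    (P : (PowerSeries F)[X]) (hP : P.Monic) (n : ℕ) (hn : P.natDegree = n + 1)
    (hnext : PowerSeries.constantCoeff (P.coeff n) = 0)
    (hex : ∃ i ≤ n, PowerSeries.constantCoeff (P.coeff i) ≠ 0) :
    ∃ G : (PowerSeries F)[X], G.Monic ∧ 0 < G.natDegree ∧ G.natDegree < n + 1 ∧ G ∣ P := by
  set φ : PowerSeries F →+* F := PowerSeries.constantCoeff with hφ
  set P0 : F[X] := P.map φ with hP0
  have hP0m : P0.Monic := hP.map φ
  have hP0d : P0.natDegree = n + 1 := by rw [hP0, hP.natDegree_map, hn]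
  obtain ⟨c, hc⟩ := IsAlgClosed.exists_root P0
    (by rw [Polynomial.degree_eq_natDegree hP0m.ne_zero, hP0d]; exact_mod_cast Nat.succ_ne_zero n)
  set m := P0.rootMultiplicity c with hm
  have hmpos : 0 < m := (Polynomial.rootMultiplicity_pos hP0m.ne_zero).2 hc
  have hmtr : m = (taylor c P0).natTrailingDegree := by
    rw [hm, Polynomial.rootMultiplicity_eq_natTrailingDegree, taylor_apply]
  have htn : taylor c P0 ≠ 0 := by rw [Ne, taylor_eq_zero]; exact hP0m.ne_zero
  have hmap : ∀ i, φ ((taylor (PowerSeries.C c) P).coeff i) = (taylor c P0).coeff i := by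
    intro i
    rw [← Polynomial.coeff_map, Polynomial.map_taylor]
    simp [hφ, hP0]
  have hmle : m < n + 1 := by
    refine lt_of_le_of_ne ?_ ?_
    · rw [← hP0d, hm]
      simpa using Polynomial.natDegree_le_of_dvd (Polynomial.pow_rootMultiplicity_dvd P0 c)
        hP0m.ne_zero
    -- If the reduction were `(X - c)^(n + 1)`, its coefficient `-(n + 1) c` of degree `n` would
    -- vanish, forcing `c = 0` in characteristic zero, against `hex`.
    · intro hmn
      have hpow : P0 = (X - C c) ^ (n + 1) := by
        have hdvd : (X - C c) ^ (n + 1) ∣ P0 := hmn ▸ Polynomial.pow_rootMultiplicity_dvd P0 c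
        refine Polynomial.eq_of_monic_of_dvd_of_natDegree_le ((monic_X_sub_C c).pow _) hP0m hdvd ?_
        rw [hP0d, natDegree_pow, natDegree_X_sub_C, mul_one]
      have hco : P0.coeff n = -((n + 1 : ℕ) : F) * c := by
        rw [hpow, sub_eq_add_neg, ← C_neg, coeff_X_add_C_pow]
        simp; ring
      have hc0 : c = 0 := by
        rw [hP0, coeff_map, hnext] at hco
        rcases mul_eq_zero.1 hco.symm with h | h
        · exact absurd (neg_eq_zero.1 h) (Nat.cast_ne_zero.2 (Nat.succ_ne_zero n))
        · exact h
      obtain ⟨i, hi, hi0⟩ := hex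
      apply hi0
      rw [← coeff_map, ← hP0, hpow, hc0, C_0, sub_zero, coeff_X_pow, if_neg (by omega)]
  obtain ⟨G, hG, hGd, hGP⟩ := exists_monic_dvd_of_coeff_mem_maximalIdeal
    (taylor (PowerSeries.C c) P) m
    (fun i hi => by
      rw [PowerSeries.mem_maximalIdeal_iff_constantCoeff, ← hφ, hmap]
      exact Polynomial.coeff_eq_zero_of_lt_natTrailingDegree (hmtr ▸ hi))
    (by
      rw [PowerSeries.mem_maximalIdeal_iff_constantCoeff, ← hφ, hmap, hmtr]
      exact fun h => htn (Polynomial.trailingCoeff_eq_zero.1 h))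
  refine ⟨taylor (-PowerSeries.C c) G, ?_, ?_, ?_, ?_⟩
  · rw [Monic, leadingCoeff_taylor]; exact hG
  · rw [natDegree_taylor, hGd]; exact hmpos
  · rw [natDegree_taylor, hGd]; exact hmle
  · obtain ⟨Q, hQ⟩ := hGP
    refine ⟨taylor (-PowerSeries.C c) Q, ?_⟩
    rw [← taylor_mul, ← hQ, taylor_taylor, neg_add_cancel, taylor_zero]

end Puiseux

/-! ### The field of Puiseux series inside Hahn series with rational exponents. -/

section Puiseux

variable {F : Type*} [Field F]

theorem injective_intCast_mul_inv (e : ℕ+) : Function.Injective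
    ((AddMonoidHom.mulRight ((e : ℚ)⁻¹)).comp (Int.castAddHom ℚ)) := by
  intro a b h
  have he : (e : ℚ) ≠ 0 := by exact_mod_cast e.ne_zero
  simpa [he] using h

/-- The embedding `F((t)) → F⟦ℚ⟧` sending `t` to `t ^ (1 / e)`. -/
noncomputable def puiseuxEmb (F : Type*) [Field F] (e : ℕ+) :
    HahnSeries ℤ F →+* HahnSeries ℚ F :=
  HahnSeries.embDomainRingHom
    ((AddMonoidHom.mulRight ((e : ℚ)⁻¹)).comp (Int.castAddHom ℚ))
    (injective_intCast_mul_inv e)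
    (fun a b => by
      have he : 0 < (e : ℚ)⁻¹ := inv_pos.2 (by exact_mod_cast e.pos)
      simp [mul_le_mul_iff_left₀ he])

theorem coeff_puiseuxEmb (e : ℕ+) (a : HahnSeries ℤ F) (n : ℤ) :
    (puiseuxEmb F e a).coeff (n * (e : ℚ)⁻¹) = a.coeff n := by
  rw [puiseuxEmb, HahnSeries.embDomainRingHom_apply]
  exact HahnSeries.embDomain_coeff (a := n)

theorem coeff_puiseuxEmb_of_forall_ne (e : ℕ+) (a : HahnSeries ℤ F) (q : ℚ)
    (hq : ∀ n : ℤ, (n : ℚ) * (e : ℚ)⁻¹ ≠ q) : (puiseuxEmb F e a).coeff q = 0 := by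
  rw [puiseuxEmb, HahnSeries.embDomainRingHom_apply]
  refine HahnSeries.embDomain_of_notMem_range ?_
  rintro ⟨n, hn⟩
  exact hq n hn

theorem puiseuxEmb_single (e : ℕ+) (n : ℤ) (c : F) :
    puiseuxEmb F e (HahnSeries.single n c) = HahnSeries.single (n * (e : ℚ)⁻¹) c := by
  rw [puiseuxEmb, HahnSeries.embDomainRingHom_apply]
  exact HahnSeries.embDomain_single

/-- Series in `t^(1/e)` are series in `t^(1/(e e'))` with exponents multiplied by `e'`. Hence the
ranges form a directed family and their union is a field. -/
theorem fieldRange_puiseuxEmb_le_mul (e e' : ℕ+) :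
    (puiseuxEmb F e).fieldRange ≤ (puiseuxEmb F (e * e')).fieldRange := by
  rintro _ ⟨a, rfl⟩
  have he : (e : ℚ) ≠ 0 := by exact_mod_cast e.ne_zero
  have he' : (e' : ℚ) ≠ 0 := by exact_mod_cast e'.ne_zero
  have hez : (e' : ℤ) ≠ 0 := by exact_mod_cast e'.ne_zero
  let f : ℤ ↪o ℤ := OrderEmbedding.ofMapLEIff (fun n => n * (e' : ℤ)) (fun m n => by
    simp)
  refine ⟨HahnSeries.embDomain f a, ?_⟩
  ext q
  by_cases hq : ∃ m : ℤ, (m : ℚ) * ((e * e' : ℕ+) : ℚ)⁻¹ = q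
  · obtain ⟨m, rfl⟩ := hq
    rw [coeff_puiseuxEmb]
    by_cases hm : ∃ n : ℤ, n * (e' : ℤ) = m
    · obtain ⟨n, rfl⟩ := hm
      have h1 : ((n * (e' : ℤ) : ℤ) : ℚ) * ((e * e' : ℕ+) : ℚ)⁻¹ = n * (e : ℚ)⁻¹ := by
        push_cast; field_simp
      rw [h1, coeff_puiseuxEmb]
      exact HahnSeries.embDomain_coeff (f := f) (a := n)
    · rw [HahnSeries.embDomain_of_notMem_range (f := f) (by
        rintro ⟨n, hn⟩; exact hm ⟨n, hn⟩), coeff_puiseuxEmb_of_forall_ne]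
      intro n hn
      apply hm
      refine ⟨n, ?_⟩
      have : (n : ℚ) * e' = m := by
        push_cast at hn; field_simp at hn; linarith
      exact_mod_cast this
  · rw [coeff_puiseuxEmb_of_forall_ne, coeff_puiseuxEmb_of_forall_ne]
    · intro n hn
      apply hq
      refine ⟨n * e', ?_⟩
      rw [← hn]; push_cast; field_simp
    · intro n hn
      exact hq ⟨n, hn⟩

/-- The field of Puiseux series, as a subfield of the Hahn series with rational exponents. -/
noncomputable def puiseuxSubfield (F : Type*) [Field F] : Subfield (HahnSeries ℚ F) where
  carrier := {z | ∃ e : ℕ+, z ∈ (puiseuxEmb F e).fieldRange}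
  mul_mem' := by
    rintro a b ⟨e, he⟩ ⟨e', he'⟩
    refine ⟨e * e', mul_mem (fieldRange_puiseuxEmb_le_mul e e' he) ?_⟩
    rw [mul_comm]; exact fieldRange_puiseuxEmb_le_mul e' e he'
  one_mem' := ⟨1, one_mem _⟩
  add_mem' := by
    rintro a b ⟨e, he⟩ ⟨e', he'⟩
    refine ⟨e * e', add_mem (fieldRange_puiseuxEmb_le_mul e e' he) ?_⟩
    rw [mul_comm]; exact fieldRange_puiseuxEmb_le_mul e' e he'
  zero_mem' := ⟨1, zero_mem _⟩
  neg_mem' := by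
    rintro a ⟨e, he⟩
    exact ⟨e, neg_mem he⟩
  inv_mem' := by
    rintro a ⟨e, he⟩
    exact ⟨e, inv_mem he⟩

theorem single_mem_puiseuxSubfield (q : ℚ) (c : F) :
    HahnSeries.single q c ∈ puiseuxSubfield F := by
  refine ⟨q.den.toPNat q.den_pos, HahnSeries.single q.num c, ?_⟩
  rw [puiseuxEmb_single]
  congr 2
  exact Rat.num_div_den q

theorem exists_common_puiseuxEmb (z : ℕ → HahnSeries ℚ F) (hz : ∀ i, z i ∈ puiseuxSubfield F)
    (N : ℕ) : ∃ e : ℕ+, ∀ i < N, z i ∈ (puiseuxEmb F e).fieldRange := by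
  induction N with
  | zero => exact ⟨1, fun i hi => absurd hi (Nat.not_lt_zero i)⟩
  | succ N ih =>
    obtain ⟨e, he⟩ := ih
    obtain ⟨d, hN⟩ := hz N
    refine ⟨e * d, fun i hi => ?_⟩
    rcases Nat.lt_succ_iff_lt_or_eq.1 hi with h | rfl
    · exact fieldRange_puiseuxEmb_le_mul e d (he i h)
    · rw [mul_comm]; exact fieldRange_puiseuxEmb_le_mul d e hN

/-- The embedding `F⟦t⟧ → F⟦ℚ⟧` sending `t` to `t ^ (1 / e)`, with values in Puiseux series. -/
noncomputable def powerSeriesToPuiseux (F : Type*) [Field F] (e : ℕ+) :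
    PowerSeries F →+* puiseuxSubfield F :=
  ((puiseuxEmb F e).comp (HahnSeries.ofPowerSeries ℤ F)).codRestrict (puiseuxSubfield F)
    (fun a => ⟨e, HahnSeries.ofPowerSeries ℤ F a, rfl⟩)

theorem coe_powerSeriesToPuiseux (e : ℕ+) (a : PowerSeries F) :
    (powerSeriesToPuiseux F e a : HahnSeries ℚ F) =
      puiseuxEmb F e (HahnSeries.ofPowerSeries ℤ F a) := rfl

theorem coeff_zero_powerSeriesToPuiseux (e : ℕ+) (a : PowerSeries F) :
    (powerSeriesToPuiseux F e a : HahnSeries ℚ F).coeff 0 = PowerSeries.constantCoeff a := by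
  have h := coeff_puiseuxEmb e (HahnSeries.ofPowerSeries ℤ F a) 0
  rw [Int.cast_zero, zero_mul] at h
  rw [coe_powerSeriesToPuiseux, h]
  simpa using HahnSeries.ofPowerSeries_apply_coeff (Γ := ℤ) a 0

theorem exists_powerSeriesToPuiseux_eq (e : ℕ+) (z : puiseuxSubfield F)
    (hz : (z : HahnSeries ℚ F) ∈ (puiseuxEmb F e).fieldRange)
    (h0 : 0 ≤ (z : HahnSeries ℚ F).orderTop) : ∃ a, powerSeriesToPuiseux F e a = z := by
  obtain ⟨a, ha⟩ := hz
  refine ⟨PowerSeries.mk fun n => a.coeff n, Subtype.ext ?_⟩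
  rw [coe_powerSeriesToPuiseux, ← ha]
  congr 1
  ext n
  rw [PowerSeries.coeff_coe]
  split_ifs with hn
  · rw [← coeff_puiseuxEmb e, ha]
    refine (HahnSeries.coeff_eq_zero_of_lt_orderTop (lt_of_lt_of_le ?_ h0)).symm
    have he : 0 < (e : ℚ)⁻¹ := inv_pos.2 (by exact_mod_cast e.pos)
    have : (n : ℚ) * (e : ℚ)⁻¹ < 0 := mul_neg_of_neg_of_pos (by exact_mod_cast hn) he
    exact_mod_cast this
  · rw [PowerSeries.coeff_mk, Int.natAbs_of_nonneg (not_lt.1 hn)]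

end Puiseux

/-! ### The Newton–Puiseux theorem. -/

section Puiseux

variable {F : Type*} [Field F]

theorem coeff_taylor_of_natDegree_eq_succ {K : Type*} [Field K] (p : K[X]) (hp : p.Monic) (n : ℕ)
    (hn : p.natDegree = n + 1) (r : K) :
    (taylor r p).coeff n = p.coeff n + (n + 1) * r := by
  have h2 : (hasseDeriv n p).natDegree < 2 := by
    have := natDegree_hasseDeriv_le p n
    omega
  have h1 : p.coeff (n + 1) = 1 := by rw [← hn]; exact hp
  rw [taylor_coeff, eval_eq_sum_range' h2]
  simp [Finset.sum_range_succ, hasseDeriv_coeff, add_comm 1 n, h1]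

theorem order_mul_single_pow {z : HahnSeries ℚ F} (hz : z ≠ 0) (q : ℚ) (m : ℕ) :
    (z * HahnSeries.single q (1 : F) ^ m).orderTop = ((z.order + m * q : ℚ) : WithTop ℚ) := by
  rw [HahnSeries.orderTop_mul, HahnSeries.single_pow, one_pow,
    HahnSeries.orderTop_single one_ne_zero, ← HahnSeries.order_eq_orderTop_of_ne_zero hz,
    nsmul_eq_mul]
  rfl

/-- A monic polynomial over Puiseux series with vanishing second coefficient that is not a power
of the variable has a proper factor. -/
theorem exists_proper_dvd_of_puiseux [IsAlgClosed F] [CharZero F]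
    (p : (puiseuxSubfield F)[X]) (hp : p.Monic) (n : ℕ)
    (hn : p.natDegree = n + 1) (hnext : p.coeff n = 0) (hex : ∃ i ≤ n, p.coeff i ≠ 0) :
    ∃ G : (puiseuxSubfield F)[X], 0 < G.natDegree ∧ G.natDegree < n + 1 ∧ G ∣ p := by
  classical
  let s : Finset ℕ := (Finset.range (n + 1)).filter fun i => p.coeff i ≠ 0
  have hs : s.Nonempty := by
    obtain ⟨i, hi, hi0⟩ := hex
    exact ⟨i, Finset.mem_filter.2 ⟨Finset.mem_range.2 (by omega), hi0⟩⟩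
  -- `ρ` is an extremal slope of the Newton polygon. Scaling the roots by `t^(-ρ)` makes every
  -- coefficient integral and gives the coefficient at `j` order exactly `0`.
  obtain ⟨j, hj, hmin⟩ := s.exists_min_image
    (fun i => (p.coeff i : HahnSeries ℚ F).order / ((n + 1 - i : ℕ) : ℚ)) hs
  set ρ : ℚ := (p.coeff j : HahnSeries ℚ F).order / ((n + 1 - j : ℕ) : ℚ) with hρ
  have hjm := Finset.mem_filter.1 hj
  have hjlt : j < n + 1 := Finset.mem_range.1 hjm.1
  let τ : puiseuxSubfield F := ⟨HahnSeries.single (-ρ) 1, single_mem_puiseuxSubfield _ _⟩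
  let τ' : puiseuxSubfield F := ⟨HahnSeries.single ρ 1, single_mem_puiseuxSubfield _ _⟩
  have hττ : τ * τ' = 1 := by
    apply Subtype.ext
    change HahnSeries.single (-ρ) (1 : F) * HahnSeries.single ρ 1 = 1
    rw [HahnSeries.single_mul_single, neg_add_cancel, one_mul]; rfl
  set q := p.scaleRoots τ with hq
  have hqm : q.Monic := (monic_scaleRoots_iff τ).2 hp
  have hqd : q.natDegree = n + 1 := by rw [hq, natDegree_scaleRoots, hn]
  have hqc : ∀ i, (q.coeff i : HahnSeries ℚ F) =
      (p.coeff i : HahnSeries ℚ F) * HahnSeries.single (-ρ) (1 : F) ^ (n + 1 - i) := by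
    intro i
    rw [hq, coeff_scaleRoots, hn]; rfl
  have hval : ∀ i, p.coeff i ≠ 0 → (q.coeff i : HahnSeries ℚ F).orderTop =
      (((p.coeff i : HahnSeries ℚ F).order + ((n + 1 - i : ℕ) : ℚ) * (-ρ) : ℚ) : WithTop ℚ) := by
    intro i hi
    rw [hqc, order_mul_single_pow (by simpa using hi)]
  have hnonneg : ∀ i, 0 ≤ (q.coeff i : HahnSeries ℚ F).orderTop := by
    intro i
    by_cases hi : p.coeff i = 0
    · rw [hqc, hi]; simp
    · rcases lt_or_ge i (n + 1) with hlt | hge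
      · have h1 := hmin i (Finset.mem_filter.2 ⟨Finset.mem_range.2 hlt, hi⟩)
        have h2 : (0 : ℚ) < ((n + 1 - i : ℕ) : ℚ) := by exact_mod_cast Nat.sub_pos_of_lt hlt
        rw [le_div_iff₀ h2] at h1
        rw [hval i hi]
        have h3 : (0 : ℚ) ≤ (p.coeff i : HahnSeries ℚ F).order + ((n + 1 - i : ℕ) : ℚ) * (-ρ) := by
          linarith
        exact_mod_cast h3
      · rcases eq_or_lt_of_le hge with h | h
        · rw [← h, ← hqd, hqm.coeff_natDegree]; simp
        · exact absurd (coeff_eq_zero_of_natDegree_lt (by omega)) hi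
  have hj0 : (q.coeff j : HahnSeries ℚ F).coeff 0 ≠ 0 := by
    apply HahnSeries.coeff_orderTop_ne
    rw [hval j hjm.2, hρ]
    have h2 : ((n + 1 - j : ℕ) : ℚ) ≠ 0 := by exact_mod_cast (Nat.sub_pos_of_lt hjlt).ne'
    rw [mul_neg, mul_div_cancel₀ _ h2, add_neg_cancel]
  -- Coefficients of index at least `n + 2` vanish, so finitely many denominators suffice and `q`
  -- lifts to power series in `t^(1/e)`.
  obtain ⟨e, he⟩ := exists_common_puiseuxEmb (fun i => (q.coeff i : HahnSeries ℚ F))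
    (fun i => (q.coeff i).2) (n + 2)
  have hlift : q ∈ Polynomial.lifts (powerSeriesToPuiseux F e) := by
    rw [Polynomial.lifts_iff_coeff_lifts]
    intro i
    rcases lt_or_ge i (n + 2) with h | h
    · exact exists_powerSeriesToPuiseux_eq e _ (he i h) (hnonneg i)
    · rw [coeff_eq_zero_of_natDegree_lt (by omega)]
      exact ⟨0, map_zero _⟩
  obtain ⟨P, hPq, hPd, hPm⟩ := Polynomial.lifts_and_natDegree_eq_and_monic hlift hqm
  have hPc : ∀ i, PowerSeries.constantCoeff (P.coeff i) = (q.coeff i : HahnSeries ℚ F).coeff 0 := by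
    intro i
    rw [← coeff_zero_powerSeriesToPuiseux e, ← hPq, coeff_map]
  obtain ⟨G, hG, hG0, hG1, hGP⟩ := exists_proper_monic_dvd_of_coeff P hPm n (hPd.trans hqd)
    (by rw [hPc, hqc, hnext]; simp) ⟨j, by omega, by rw [hPc]; exact hj0⟩
  refine ⟨(G.map (powerSeriesToPuiseux F e)).scaleRoots τ', ?_, ?_, ?_⟩
  · rwa [natDegree_scaleRoots, hG.natDegree_map]
  · rwa [natDegree_scaleRoots, hG.natDegree_map]
  · have h := scaleRoots_dvd _ _ (r := τ') (Polynomial.map_dvd (powerSeriesToPuiseux F e) hGP)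
    rwa [hPq, hq, ← scaleRoots_mul, hττ, scaleRoots_one] at h

/-- **Newton–Puiseux theorem**. -/
theorem isAlgClosed_puiseuxSubfield [IsAlgClosed F] [CharZero F] :
    IsAlgClosed (puiseuxSubfield F) := by
  have : CharZero (puiseuxSubfield F) := by
    have : CharZero (HahnSeries ℚ F) := charZero_of_injective_ringHom (HahnSeries.C_injective)
    exact (puiseuxSubfield F).subtype.charZero
  refine IsAlgClosed.of_exists_root _ fun p hp hirr => ?_
  obtain ⟨n, hn⟩ : ∃ n, p.natDegree = n + 1 :=
    ⟨p.natDegree - 1, by have := hirr.natDegree_pos; omega⟩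
  have hn0 : (n + 1 : puiseuxSubfield F) ≠ 0 := by exact_mod_cast Nat.succ_ne_zero n
  -- Tschirnhaus translation, removing the coefficient of degree `n`.
  set r : puiseuxSubfield F := -(p.coeff n / (n + 1)) with hr
  have hirr' : Irreducible (taylor r p) := (MulEquiv.irreducible_iff (taylorEquiv r)).2 hirr
  have hm' : (taylor r p).Monic := by rw [Monic, leadingCoeff_taylor]; exact hp
  have hd' : (taylor r p).natDegree = n + 1 := by rw [natDegree_taylor, hn]
  have hc' : (taylor r p).coeff n = 0 := by
    rw [coeff_taylor_of_natDegree_eq_succ p hp n hn, hr]; field_simp; ring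
  by_cases hex : ∃ i ≤ n, (taylor r p).coeff i ≠ 0
  · obtain ⟨G, h0, h1, Q, hQ⟩ := exists_proper_dvd_of_puiseux _ hm' n hd' hc' hex
    have hG0 : G ≠ 0 := by rintro rfl; simp at h0
    have hQ0 : Q ≠ 0 := by rintro rfl; rw [mul_zero] at hQ; exact hirr'.ne_zero hQ
    have hdeg := natDegree_mul hG0 hQ0
    rw [← hQ, hd'] at hdeg
    rcases hirr'.isUnit_or_isUnit hQ with h | h
    · have := natDegree_eq_zero_of_isUnit h; omega
    · have := natDegree_eq_zero_of_isUnit h; omega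
  · push Not at hex
    refine ⟨0 + r, ?_⟩
    rw [← taylor_eval, ← coeff_zero_eq_eval_zero]
    exact hex 0 (Nat.zero_le n)

end Puiseux

/-- An additive self-map of a ring satisfying the product rule. -/
def IsLeibniz {A : Type*} [CommRing A] (D : A →+ A) : Prop :=
  ∀ a b, D (a * b) = a * D b + b * D a

theorem IsLeibniz.map_one {A : Type*} [CommRing A] {D : A →+ A} (hD : IsLeibniz D) : D 1 = 0 := by
  have h := hD 1 1
  rw [mul_one, one_mul] at h
  exact left_eq_add.1 h

/-! ### Differentiation and principal units in Hahn series. -/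

section HahnDeriv

variable {F : Type*} [Field F]

/-- The Euler operator on Hahn series, multiplying each coefficient by its exponent. -/
noncomputable def hahnEuler (F : Type*) [Field F] (z : HahnSeries ℚ F) : HahnSeries ℚ F where
  coeff q := (q : F) * z.coeff q
  isPWO_support' := z.isPWO_support.mono fun q hq h => hq (by
    simp only [h, mul_zero])

theorem coeff_hahnEuler (z : HahnSeries ℚ F) (q : ℚ) :
    (hahnEuler F z).coeff q = (q : F) * z.coeff q := rfl

theorem support_hahnEuler_subset (z : HahnSeries ℚ F) :
    (hahnEuler F z).support ⊆ z.support := fun q hq h => hq (by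
  change (q : F) * z.coeff q = 0
  rw [h, mul_zero])

theorem hahnEuler_mul [CharZero F] (z w : HahnSeries ℚ F) :
    hahnEuler F (z * w) = z * hahnEuler F w + w * hahnEuler F z := by
  ext q
  -- The Euler operator only shrinks supports, so all three products are summed over one
  -- antidiagonal, where `q = i + j` distributes the factor `q`.
  rw [mul_comm w, HahnSeries.coeff_add, coeff_hahnEuler, HahnSeries.coeff_mul,
    HahnSeries.coeff_mul_left' z.isPWO_support (support_hahnEuler_subset z),
    HahnSeries.coeff_mul_right' w.isPWO_support (support_hahnEuler_subset w),
    ← Finset.sum_add_distrib, Finset.mul_sum]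
  refine Finset.sum_congr rfl fun ij hij => ?_
  have h := (Finset.mem_antidiagonal.1 hij).2.2
  rw [coeff_hahnEuler, coeff_hahnEuler, ← h]
  push_cast; ring

/-- Differentiation with respect to `x = t⁻¹` on Hahn series in `t`. -/
noncomputable def hahnDeriv (F : Type*) [Field F] : HahnSeries ℚ F →+ HahnSeries ℚ F :=
  AddMonoidHom.mk' (fun z => -HahnSeries.single (1 : ℚ) (1 : F) * hahnEuler F z) fun z w => by
    rw [← mul_add]
    congr 1
    ext q
    simp only [coeff_hahnEuler, HahnSeries.coeff_add, mul_add]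

theorem hahnDeriv_apply (z : HahnSeries ℚ F) :
    hahnDeriv F z = -HahnSeries.single (1 : ℚ) (1 : F) * hahnEuler F z := rfl

theorem isLeibniz_hahnDeriv [CharZero F] : IsLeibniz (hahnDeriv F) := fun z w => by
  simp only [hahnDeriv_apply, hahnEuler_mul]
  ring

theorem coeff_hahnDeriv (z : HahnSeries ℚ F) (q : ℚ) :
    (hahnDeriv F z).coeff (q + 1) = -((q : F) * z.coeff q) := by
  rw [hahnDeriv_apply, neg_mul, HahnSeries.coeff_neg, HahnSeries.coeff_single_mul_add,
    coeff_hahnEuler, one_mul]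

theorem hahnDeriv_single (q : ℚ) (c : F) :
    hahnDeriv F (HahnSeries.single q c) = HahnSeries.single (q + 1) (-(q * c)) := by
  ext p
  obtain ⟨p', rfl⟩ : ∃ p', p = p' + 1 := ⟨p - 1, by ring⟩
  rw [coeff_hahnDeriv, HahnSeries.coeff_single, HahnSeries.coeff_single]
  by_cases h : p' = q
  · subst h; simp
  · simp [h]

theorem lt_orderTop_hahnDeriv {z : HahnSeries ℚ F} (hz : 0 < z.orderTop) :
    1 < (hahnDeriv F z).orderTop := by
  have h0 : 0 < (hahnEuler F z).orderTop := by
    refine lt_of_lt_of_le hz ?_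
    rw [HahnSeries.le_orderTop_iff_forall]
    intro j hj
    rw [coeff_hahnEuler, HahnSeries.coeff_eq_zero_of_lt_orderTop hj, mul_zero]
  rw [hahnDeriv_apply, neg_mul, HahnSeries.orderTop_neg, HahnSeries.orderTop_mul,
    HahnSeries.orderTop_single one_ne_zero]
  generalize (hahnEuler F z).orderTop = y at h0
  induction y using WithTop.recTopCoe with
  | top => exact WithTop.coe_lt_top 1
  | coe y =>
    have : (1 : ℚ) < 1 + y := by have : (0 : ℚ) < y := by exact_mod_cast h0
                                 linarith
    exact_mod_cast this

theorem HahnSeries.exists_eq_single_mul_one_add {z : HahnSeries ℚ F} (hz : z ≠ 0) :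
    ∃ δ : HahnSeries ℚ F, 0 < δ.orderTop ∧
      z = HahnSeries.single z.order z.leadingCoeff * (1 + δ) := by
  have hl : z.leadingCoeff ≠ 0 := HahnSeries.leadingCoeff_ne_zero.2 hz
  have hs : HahnSeries.single z.order z.leadingCoeff ≠ 0 := by simpa using hz
  refine ⟨(HahnSeries.single z.order z.leadingCoeff)⁻¹ * z - 1, ?_, ?_⟩
  · rw [HahnSeries.orderTop_self_sub_one_pos_iff, HahnSeries.inv_single, HahnSeries.orderTop_mul,
      HahnSeries.leadingCoeff_mul, HahnSeries.orderTop_single (inv_ne_zero hl),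
      HahnSeries.leadingCoeff_of_single, inv_mul_cancel₀ hl,
      ← HahnSeries.order_eq_orderTop_of_ne_zero hz]
    refine ⟨?_, rfl⟩
    rw [← WithTop.coe_add, neg_add_cancel]; rfl
  · rw [add_sub_cancel, mul_inv_cancel_left₀ hs]

theorem HahnSeries.single_zpow' (v : ℚ) (c : F) (hc : c ≠ 0) (k : ℤ) :
    HahnSeries.single v c ^ k = HahnSeries.single (k * v) (c ^ k) := by
  have hs : HahnSeries.single v c ≠ 0 := by simpa using hc
  induction k using Int.induction_on with
  | zero => simp
  | succ n ih =>
    rw [zpow_add_one₀ hs, ih, HahnSeries.single_mul_single, zpow_add_one₀ hc]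
    congr 2; push_cast; ring
  | pred n ih =>
    rw [zpow_sub_one₀ hs, ih, HahnSeries.inv_single, HahnSeries.single_mul_single,
      zpow_sub_one₀ hc]
    congr 2; push_cast; ring

/-- First-order binomial expansion of an integer power of a principal unit. -/
theorem HahnSeries.exists_one_add_zpow {δ : HahnSeries ℚ F} (hδ : 0 < δ.orderTop) (k : ℤ) :
    ∃ ε : HahnSeries ℚ F, δ.orderTop + δ.orderTop ≤ ε.orderTop ∧
      (1 + δ) ^ k = 1 + k * δ + ε := by
  have h1 : (1 + δ) ≠ 0 := by
    intro h
    rw [eq_neg_of_add_eq_zero_right h, HahnSeries.orderTop_neg, HahnSeries.orderTop_one] at hδ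
    exact lt_irrefl _ hδ
  have ho : (1 + δ).orderTop = 0 := by
    rw [HahnSeries.orderTop_add_eq_left (by rwa [HahnSeries.orderTop_one]),
      HahnSeries.orderTop_one]
  have hoinv : ((1 + δ)⁻¹).orderTop = 0 := by
    have h := HahnSeries.orderTop_mul (1 + δ) (1 + δ)⁻¹
    rw [mul_inv_cancel₀ h1, HahnSeries.orderTop_one, ho, zero_add] at h
    exact h.symm
  have hδδ : δ.orderTop + δ.orderTop ≤ (δ * δ).orderTop := (HahnSeries.orderTop_mul _ _).ge
  have hint : ∀ m : ℤ, 0 ≤ ((m : HahnSeries ℚ F)).orderTop := by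
    intro m
    rw [← HahnSeries.single_zero_intCast]
    exact HahnSeries.orderTop_single_le
  induction k using Int.induction_on with
  | zero => exact ⟨0, by simp, by simp⟩
  | succ n ih =>
    obtain ⟨ε, hε, h⟩ := ih
    refine ⟨(n : ℤ) * (δ * δ) + ε * (1 + δ), ?_, ?_⟩
    · refine le_trans (le_min ?_ ?_) HahnSeries.min_orderTop_le_orderTop_add
      · rw [HahnSeries.orderTop_mul]
        exact le_add_of_nonneg_of_le (hint _) hδδ
      · rwa [HahnSeries.orderTop_mul, ho, add_zero]
    · rw [zpow_add_one₀ h1, h]; push_cast; ring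
  | pred n ih =>
    obtain ⟨ε, hε, h⟩ := ih
    refine ⟨(((n : ℤ) + 1) * (δ * δ) + ε) * (1 + δ)⁻¹, ?_, ?_⟩
    · rw [HahnSeries.orderTop_mul, hoinv, add_zero]
      refine le_trans (le_min ?_ hε) HahnSeries.min_orderTop_le_orderTop_add
      rw [HahnSeries.orderTop_mul]
      refine le_add_of_nonneg_of_le ?_ hδδ
      have := hint (n + 1)
      push_cast at this ⊢
      exact this
    · rw [zpow_sub_one₀ h1, h]
      field_simp
      push_cast; ring

/-- Leading term of the logarithmic derivative. -/
theorem exists_hahnDeriv_eq_mul [CharZero F] {z : HahnSeries ℚ F} (hz : z ≠ 0) :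
    ∃ w : HahnSeries ℚ F, 0 < w.orderTop ∧
      hahnDeriv F z = z * (HahnSeries.single 1 (1 : F) * (HahnSeries.C (-(z.order : F)) + w)) := by
  obtain ⟨δ, hδ, h⟩ := HahnSeries.exists_eq_single_mul_one_add hz
  have hs1 : HahnSeries.single (1 : ℚ) (1 : F) ≠ 0 := by simp
  have h1 : (1 + δ) ≠ 0 := by
    intro h0
    rw [h0, mul_zero] at h; exact hz h
  have ho : (1 + δ).orderTop = 0 := by
    rw [HahnSeries.orderTop_add_eq_left (by rwa [HahnSeries.orderTop_one]),
      HahnSeries.orderTop_one]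
  refine ⟨(HahnSeries.single (1 : ℚ) (1 : F))⁻¹ * hahnDeriv F δ * (1 + δ)⁻¹, ?_, ?_⟩
  · have h2 := HahnSeries.orderTop_mul (1 + δ)
      ((HahnSeries.single (1 : ℚ) (1 : F))⁻¹ * hahnDeriv F δ * (1 + δ)⁻¹)
    rw [ho, zero_add] at h2
    rw [← h2, mul_comm, inv_mul_cancel_right₀ h1, HahnSeries.inv_single, HahnSeries.orderTop_mul,
      inv_one, HahnSeries.orderTop_single one_ne_zero]
    have h3 := lt_orderTop_hahnDeriv hδ
    generalize (hahnDeriv F δ).orderTop = y at h3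
    induction y using WithTop.recTopCoe with
    | top => exact WithTop.coe_lt_top 0
    | coe y =>
      have : (0 : ℚ) < -1 + y := by have : (1 : ℚ) < y := by exact_mod_cast h3
                                    linarith
      exact_mod_cast this
  · have hD : hahnDeriv F (HahnSeries.single z.order z.leadingCoeff) =
        HahnSeries.single z.order z.leadingCoeff *
          (HahnSeries.single (1 : ℚ) (1 : F) * HahnSeries.C (-(z.order : F))) := by
      rw [hahnDeriv_single, HahnSeries.C_apply, HahnSeries.single_mul_single,
        HahnSeries.single_mul_single]
      congr 1
      · simp
      · ring
    calc hahnDeriv F z = hahnDeriv F (HahnSeries.single z.order z.leadingCoeff * (1 + δ)) := by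
          rw [← h]
      _ = HahnSeries.single z.order z.leadingCoeff * (1 + δ) *
          (HahnSeries.single 1 (1 : F) * (HahnSeries.C (-(z.order : F)) +
            (HahnSeries.single (1 : ℚ) (1 : F))⁻¹ * hahnDeriv F δ * (1 + δ)⁻¹)) := by
          rw [isLeibniz_hahnDeriv, hD, map_add, isLeibniz_hahnDeriv.map_one]
          field_simp
          ring
      _ = _ := by rw [← h]

end HahnDeriv

/-! ### Asymptotics at infinity of solutions of `z^r z' = A x^α z^s + B x^β`. -/

section RootAsymptotics

variable {F : Type*} [Field F]

theorem HahnSeries.coeff_single_mul_of_lt {Y : HahnSeries ℚ F} (hY : 0 ≤ Y.orderTop) (a : ℚ) (c : F)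
    {q : ℚ} (hq : q < a) : (HahnSeries.single a c * Y).coeff q = 0 := by
  have h := HahnSeries.coeff_single_mul_add (r := c) (x := Y) (a := q - a) (b := a)
  rw [sub_add_cancel] at h
  rw [h, HahnSeries.coeff_eq_zero_of_lt_orderTop (lt_of_lt_of_le ?_ hY), mul_zero]
  exact_mod_cast sub_neg.2 hq

theorem HahnSeries.coeff_single_mul_self (Y : HahnSeries ℚ F) (a : ℚ) (c : F) :
    (HahnSeries.single a c * Y).coeff a = c * Y.coeff 0 := by
  have h := HahnSeries.coeff_single_mul_add (r := c) (x := Y) (a := 0) (b := a)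
  rwa [zero_add] at h

theorem HahnSeries.orderTop_add_pos {x y : HahnSeries ℚ F} (hx : 0 < x.orderTop)
    (hy : 0 < y.orderTop) : 0 < (x + y).orderTop :=
  lt_of_lt_of_le (lt_min hx hy) HahnSeries.min_orderTop_le_orderTop_add

theorem HahnSeries.orderTop_mul_pos {x y : HahnSeries ℚ F} (hx : 0 ≤ x.orderTop)
    (hy : 0 < y.orderTop) : 0 < (x * y).orderTop := by
  rw [HahnSeries.orderTop_mul]
  exact lt_of_lt_of_le hy (le_add_of_nonneg_left hx)

theorem HahnSeries.orderTop_intCast_nonneg (m : ℤ) : 0 ≤ ((m : HahnSeries ℚ F)).orderTop := by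
  rw [← HahnSeries.single_zero_intCast]
  exact HahnSeries.orderTop_single_le

theorem HahnSeries.exists_one_add_zpow_eq_one_add {δ : HahnSeries ℚ F} (hδ : 0 < δ.orderTop)
    (k : ℤ) : ∃ δ' : HahnSeries ℚ F, 0 < δ'.orderTop ∧ (1 + δ) ^ k = 1 + δ' := by
  obtain ⟨ε, hε, h⟩ := HahnSeries.exists_one_add_zpow hδ k
  refine ⟨k * δ + ε, HahnSeries.orderTop_add_pos
    (HahnSeries.orderTop_mul_pos (HahnSeries.orderTop_intCast_nonneg k) hδ)
    (lt_of_lt_of_le ?_ hε), by rw [h, add_assoc]⟩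
  exact lt_of_lt_of_le hδ (le_add_of_nonneg_left hδ.le)

theorem HahnSeries.coeff_zero_add_of_pos (c : F) {w : HahnSeries ℚ F} (hw : 0 < w.orderTop) :
    0 ≤ (HahnSeries.C c + w).orderTop ∧ (HahnSeries.C c + w).coeff 0 = c := by
  refine ⟨le_trans (le_min ?_ hw.le) HahnSeries.min_orderTop_le_orderTop_add, ?_⟩
  · exact HahnSeries.orderTop_single_le
  · rw [HahnSeries.coeff_add, HahnSeries.coeff_eq_zero_of_lt_orderTop (i := 0) hw, add_zero]
    simp [HahnSeries.C_apply]

/-- Factorisation of a monomial multiple of an integer power through its leading term. -/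
theorem HahnSeries.single_mul_zpow_eq {z δ : HahnSeries ℚ F} {v : ℚ} {c : F} (hc : c ≠ 0)
    (hz : z = HahnSeries.single v c * (1 + δ)) (a : ℚ) (b : F) (k : ℤ) :
    HahnSeries.single a b * z ^ k =
      HahnSeries.single (a + k * v) (b * c ^ k) * (1 + δ) ^ k := by
  rw [hz, mul_zpow, HahnSeries.single_zpow' v c hc, ← mul_assoc, HahnSeries.single_mul_single]

theorem HahnSeries.coeff_single_mul_zpow {z : HahnSeries ℚ F} (hz : z ≠ 0)
    (a : ℚ) (b : F) (k : ℤ) :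
    (∀ q < a + k * z.order, (HahnSeries.single a b * z ^ k).coeff q = 0) ∧
      (HahnSeries.single a b * z ^ k).coeff (a + k * z.order) = b * z.leadingCoeff ^ k := by
  obtain ⟨δ, hδ, h⟩ := HahnSeries.exists_eq_single_mul_one_add hz
  obtain ⟨δ', hδ', h'⟩ := HahnSeries.exists_one_add_zpow_eq_one_add hδ k
  have hc := HahnSeries.coeff_zero_add_of_pos (1 : F) hδ'
  rw [map_one] at hc
  rw [HahnSeries.single_mul_zpow_eq (HahnSeries.leadingCoeff_ne_zero.2 hz) h, h']
  refine ⟨fun q hq => HahnSeries.coeff_single_mul_of_lt hc.1 _ _ hq, ?_⟩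
  rw [HahnSeries.coeff_single_mul_self, hc.2, mul_one]

variable [CharZero F]

/-- Differentiation multiplies the leading term by `-z.order * t`. That factor is zero when the
order is zero, so coefficients are recorded here and not an order. -/
theorem coeff_pow_mul_hahnDeriv {z : HahnSeries ℚ F} (hz : z ≠ 0) (r : ℕ) :
    (∀ q < (r + 1) * z.order + 1, (z ^ r * hahnDeriv F z).coeff q = 0) ∧
      (z ^ r * hahnDeriv F z).coeff ((r + 1) * z.order + 1) =
        -(z.order : F) * z.leadingCoeff ^ (r + 1) := by
  obtain ⟨δ, hδ, h⟩ := HahnSeries.exists_eq_single_mul_one_add hz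
  obtain ⟨δ', hδ', h'⟩ := HahnSeries.exists_one_add_zpow_eq_one_add hδ (r + 1 : ℕ)
  obtain ⟨w, hw, hD⟩ := exists_hahnDeriv_eq_mul hz
  have hl := HahnSeries.leadingCoeff_ne_zero.2 hz
  have key : z ^ r * hahnDeriv F z =
      HahnSeries.single ((r + 1) * z.order + 1) (z.leadingCoeff ^ (r + 1)) *
        (HahnSeries.C (-(z.order : F)) +
          (w + δ' * (HahnSeries.C (-(z.order : F)) + w))) := by
    have h2 := HahnSeries.single_mul_zpow_eq hl h 1 1 (r + 1 : ℕ)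
    rw [h', zpow_natCast, zpow_natCast, one_mul, add_comm (1 : ℚ)] at h2
    push_cast at h2
    rw [hD, show ∀ t : HahnSeries ℚ F, z ^ r * (z * (HahnSeries.single 1 (1 : F) * t)) =
      HahnSeries.single 1 (1 : F) * z ^ (r + 1) * t from fun t => by ring, h2]
    ring
  have hpos : 0 < (w + δ' * (HahnSeries.C (-(z.order : F)) + w)).orderTop := by
    refine HahnSeries.orderTop_add_pos hw ?_
    rw [mul_comm]
    exact HahnSeries.orderTop_mul_pos (HahnSeries.coeff_zero_add_of_pos _ hw).1 hδ'
  have hc := HahnSeries.coeff_zero_add_of_pos (-(z.order : F)) hpos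
  rw [key]
  refine ⟨fun q hq => HahnSeries.coeff_single_mul_of_lt hc.1 _ _ hq, ?_⟩
  rw [HahnSeries.coeff_single_mul_self, hc.2, mul_comm]

/-- Balance of leading terms for a solution of `z ^ r z' = A x ^ α z ^ s + B x ^ β`: either the two
terms on the right cancel, or the left side dominates both. -/
theorem leading_balance {z : HahnSeries ℚ F} (hz : z ≠ 0) {r s α β : ℕ} {A B : F} (hA : A ≠ 0)
    (hB : B ≠ 0)
    (heq : z ^ r * hahnDeriv F z =
      HahnSeries.single (-(α : ℚ)) A * z ^ s + HahnSeries.single (-(β : ℚ)) B) :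
    (-(α : ℚ) + s * z.order = -β ∧ A * z.leadingCoeff ^ s + B = 0) ∨
      ((r + 1) * z.order + 1 ≤ -(α : ℚ) + s * z.order ∧ (r + 1) * z.order + 1 ≤ -(β : ℚ)) := by
  have hl := HahnSeries.leadingCoeff_ne_zero.2 hz
  obtain ⟨hL, -⟩ := coeff_pow_mul_hahnDeriv hz r
  obtain ⟨hR, hR'⟩ := HahnSeries.coeff_single_mul_zpow hz (-(α : ℚ)) A s
  rw [zpow_natCast] at hR hR'
  rw [zpow_natCast] at hR'
  rw [Int.cast_natCast] at hR hR'
  rw [heq] at hL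
  rw [or_iff_not_imp_right]
  intro hn
  -- By `hn` the left side has no term at the smaller right-hand exponent. A lone right-hand term
  -- there would be nonzero, so the two exponents must agree.
  rcases lt_trichotomy (-(α : ℚ) + s * z.order) (-(β : ℚ)) with h | h | h
  · exfalso
    have h1 := hL (-(α : ℚ) + s * z.order) (by by_contra h'; apply hn; constructor <;> linarith)
    rw [HahnSeries.coeff_add, hR', HahnSeries.coeff_single_of_ne h.ne, add_zero] at h1
    exact mul_ne_zero hA (pow_ne_zero _ hl) h1
  · refine ⟨h, ?_⟩
    have h1 := hL (-(α : ℚ) + s * z.order) (by by_contra h'; apply hn; constructor <;> linarith)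
    rwa [HahnSeries.coeff_add, hR', h, HahnSeries.coeff_single_same] at h1
  · exfalso
    have h1 := hL (-(β : ℚ)) (by by_contra h'; apply hn; constructor <;> linarith)
    rw [HahnSeries.coeff_add, hR _ h, HahnSeries.coeff_single_same, zero_add] at h1
    exact hB h1

/-- The coefficient of `x⁻¹` in `A x ^ α z ^ (s - r - 1)`, for a solution `z` of
`z ^ r z' = A x ^ α z ^ s + B x ^ β` whose leading term cancels the right side. -/
theorem coeff_one_of_cancel {z : HahnSeries ℚ F} (hz : z ≠ 0) {r s α β : ℕ} {A B : F}
    (hB : B ≠ 0) (hs : s ≠ 0) (hv : z.order ≠ 0)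
    (heq : z ^ r * hahnDeriv F z =
      HahnSeries.single (-(α : ℚ)) A * z ^ s + HahnSeries.single (-(β : ℚ)) B)
    (hord : -(α : ℚ) + s * z.order = -β) (hlead : A * z.leadingCoeff ^ s + B = 0) :
    (HahnSeries.single (-(α : ℚ)) A * z ^ ((s : ℤ) - r - 1)).coeff 1 =
      ((-z.order * (s - r - 1) / s : ℚ) : F) := by
  have hl := HahnSeries.leadingCoeff_ne_zero.2 hz
  have hsF : (s : F) ≠ 0 := Nat.cast_ne_zero.2 hs
  have hvF : (z.order : F) ≠ 0 := by exact_mod_cast hv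
  obtain ⟨δ, hδ, h⟩ := HahnSeries.exists_eq_single_mul_one_add hz
  obtain ⟨ε, hε, hpow⟩ := HahnSeries.exists_one_add_zpow hδ s
  obtain ⟨ε', hε', hpow'⟩ := HahnSeries.exists_one_add_zpow hδ ((s : ℤ) - r - 1)
  obtain ⟨hL, hL'⟩ := coeff_pow_mul_hahnDeriv hz r
  set v := z.order with hvdef
  set c := z.leadingCoeff with hcdef
  -- Once the leading terms on the right cancel, `-B t^(-β) (s δ + ...)` must match `z^r z'`, which
  -- starts at exponent `(r + 1) v + 1`. So `δ` starts at exponent `e`, with a coefficient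
  -- determined by `B * s * δ_e = v * c^(r + 1)`.
  set e : ℚ := (r + 1) * v + 1 + β with he
  set g : HahnSeries ℚ F := (s : ℤ) * δ + ε with hg
  have hAB : A * c ^ s = -B := eq_neg_of_add_eq_zero_left hlead
  have hR : z ^ r * hahnDeriv F z = HahnSeries.single (-(β : ℚ)) (-B) * g := by
    have h2 := HahnSeries.single_mul_zpow_eq hl h (-(α : ℚ)) A s
    rw [hpow, zpow_natCast, zpow_natCast, Int.cast_natCast (R := ℚ), hord, hAB] at h2
    rw [heq, h2, add_assoc, mul_add, mul_one, ← hg, HahnSeries.single_neg]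
    ring
  have hcoeff : ∀ q, (z ^ r * hahnDeriv F z).coeff (q - β) = -B * g.coeff q := by
    intro q
    rw [hR, sub_eq_add_neg, HahnSeries.coeff_single_mul_add]
  have hg0 : ∀ q < e, g.coeff q = 0 := by
    intro q hq
    have h1 := hcoeff q
    rw [hL _ (by rw [he] at hq; linarith)] at h1
    exact (mul_eq_zero.1 h1.symm).resolve_left (neg_ne_zero.2 hB)
  have hge : -B * g.coeff e = -(v : F) * c ^ (r + 1) := by
    rw [← hcoeff e, ← hL']
    congr 1
    rw [he]; ring
  have hge0 : g.coeff e ≠ 0 := by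
    intro h0
    rw [h0, mul_zero] at hge
    exact mul_ne_zero (neg_ne_zero.2 hvF) (pow_ne_zero _ hl) hge.symm
  have hgord : g.orderTop = e := by
    refine le_antisymm (HahnSeries.orderTop_le_of_coeff_ne_zero hge0) ?_
    rw [HahnSeries.le_orderTop_iff_forall]
    intro j hj
    exact hg0 j (by exact_mod_cast hj)
  have hδ0 : δ ≠ 0 := by
    rintro rfl
    have : ε = 0 := by
      rw [HahnSeries.orderTop_zero] at hε
      exact HahnSeries.orderTop_eq_top.1 (top_le_iff.1 hε)
    apply hge0
    rw [hg, this]; simp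
  have hsδ : (((s : ℤ) : HahnSeries ℚ F) * δ).orderTop = δ.orderTop := by
    rw [HahnSeries.orderTop_mul, ← HahnSeries.single_zero_intCast, HahnSeries.orderTop_single
      (by exact_mod_cast hs)]
    exact zero_add _
  have hδe : δ.orderTop = e := by
    obtain ⟨d, hd⟩ := WithTop.ne_top_iff_exists.1 (HahnSeries.orderTop_ne_top.2 hδ0)
    rw [← hd] at hδ hε hsδ ⊢
    have hd0 : (0 : ℚ) < d := by exact_mod_cast hδ
    rw [← hgord, hg, HahnSeries.orderTop_add_eq_left, hsδ]
    rw [hsδ]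
    refine lt_of_lt_of_le ?_ hε
    exact_mod_cast (by linarith : d < d + d)
  have he0 : 0 < e := by rw [hδe] at hδ; exact_mod_cast hδ
  have hεe : ∀ y : HahnSeries ℚ F, δ.orderTop + δ.orderTop ≤ y.orderTop → y.coeff e = 0 := by
    intro y hy
    refine HahnSeries.coeff_eq_zero_of_lt_orderTop (lt_of_lt_of_le ?_ hy)
    rw [hδe]
    exact_mod_cast (by linarith : e < e + e)
  have hmul : ∀ m : ℤ, ((m : HahnSeries ℚ F) * δ).coeff e = m * δ.coeff e := by
    intro m
    rw [← HahnSeries.single_zero_intCast, HahnSeries.coeff_single_zero_mul]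
  have hge' : g.coeff e = s * δ.coeff e := by
    rw [hg, HahnSeries.coeff_add, hεe ε hε, hmul, add_zero, Int.cast_natCast]
  have hone : (1 : HahnSeries ℚ F).coeff e = 0 := by
    rw [HahnSeries.coeff_one, if_neg he0.ne']
  rw [HahnSeries.single_mul_zpow_eq hl h, hpow']
  -- Exponent `1` lies exactly `e` above the leading exponent, so only the linear term in `δ`
  -- contributes to the residue.
  have hexp : (1 : ℚ) = e + (-(α : ℚ) + (((s : ℤ) - r - 1 : ℤ) : ℚ) * v) := by
    rw [he]; push_cast; linear_combination -hord
  conv_lhs => rw [hexp]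
  rw [HahnSeries.coeff_single_mul_add, HahnSeries.coeff_add, HahnSeries.coeff_add, hone,
    hεe ε' hε', hmul, zero_add, add_zero]
  have hck : A * c ^ ((s : ℤ) - r - 1) * c ^ (r + 1) = -B := by
    rw [← hAB, mul_assoc]
    congr 1
    rw [← zpow_natCast c (r + 1), ← zpow_add₀ hl, ← zpow_natCast c s]
    congr 1; push_cast; ring
  rw [hge'] at hge
  push_cast
  rw [eq_div_iff hsF]
  have hcr : c ^ (r + 1) ≠ 0 := pow_ne_zero _ hl
  apply mul_right_cancel₀ hcr
  have h5 : B * (s * δ.coeff e) = v * c ^ (r + 1) := by linear_combination -hge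
  linear_combination ((s : F) - r - 1) * δ.coeff e * s * hck - ((s : F) - r - 1) * h5

/-- Solutions of `z ^ r z' = A x ^ α z ^ s + B x ^ β` for `r < s`. -/
theorem order_and_coeff_one_of_lt {z : HahnSeries ℚ F} (hz : z ≠ 0) {r s α β : ℕ} {A B : F}
    (hA : A ≠ 0) (hB : B ≠ 0) (hrs : r < s) (hαβ : α ≠ β)
    (heq : z ^ r * hahnDeriv F z =
      HahnSeries.single (-(α : ℚ)) A * z ^ s + HahnSeries.single (-(β : ℚ)) B) :
    z.order = ((α : ℚ) - β) / s ∧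
    (HahnSeries.single (-(α : ℚ)) A * z ^ ((s : ℤ) - r - 1)).coeff 1 =
      ((((β : ℚ) - α) / s * (s - r - 1) / s : ℚ) : F) := by
  have hs0 : (0 : ℚ) < s := by exact_mod_cast (Nat.zero_le r).trans_lt hrs
  have hrs' : (r : ℚ) + 1 ≤ s := by exact_mod_cast hrs
  have hα : (0 : ℚ) ≤ α := Nat.cast_nonneg α
  have hβ : (0 : ℚ) ≤ β := Nat.cast_nonneg β
  have hr : (0 : ℚ) ≤ r := Nat.cast_nonneg r
  rcases leading_balance hz hA hB heq with ⟨h1, h2⟩ | ⟨h1, h2⟩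
  · have hord : z.order = ((α : ℚ) - β) / s := by
      rw [eq_div_iff hs0.ne']; linarith
    have hne : (α : ℚ) - β ≠ 0 := sub_ne_zero.2 (by exact_mod_cast hαβ)
    refine ⟨hord, ?_⟩
    rw [coeff_one_of_cancel hz hB (by omega) (by rw [hord]; exact div_ne_zero hne hs0.ne') heq h1
      h2, hord]
    congr 1; ring
  -- The second inequality forces a negative order. The first then reads `1 + α ≤ (s - r - 1) *
  -- z.order ≤ 0`.
  · exfalso
    have hv : z.order < 0 := by
      by_contra hv
      have := mul_nonneg (by linarith : (0 : ℚ) ≤ r + 1) (not_lt.1 hv)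
      linarith
    have := mul_nonneg (sub_nonneg.2 hrs') (neg_nonneg.2 hv.le)
    linarith

/-- Solutions of `z ^ r z' = A x ^ α z ^ s + B` for `0 < s ≤ r` and `0 < α`. -/
theorem exists_pos_coeff_one_of_le {z : HahnSeries ℚ F} (hz : z ≠ 0) {r s α : ℕ} {A B : F}
    (hA : A ≠ 0) (hB : B ≠ 0) (hs : 0 < s) (hsr : s ≤ r) (hα : 0 < α)
    (heq : z ^ r * hahnDeriv F z =
      HahnSeries.single (-(α : ℚ)) A * z ^ s + HahnSeries.single (-((0 : ℕ) : ℚ)) B) :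
    ∃ q : ℚ, 0 < q ∧
      (HahnSeries.single (-(α : ℚ)) A * z ^ ((s : ℤ) - r - 1)).coeff 1 = (q : F) := by
  have hs0 : (0 : ℚ) < s := by exact_mod_cast hs
  have hsr' : (s : ℚ) ≤ r := by exact_mod_cast hsr
  have hα0 : (0 : ℚ) < α := by exact_mod_cast hα
  have hr : (0 : ℚ) ≤ r := Nat.cast_nonneg r
  have hl := HahnSeries.leadingCoeff_ne_zero.2 hz
  rcases leading_balance hz hA hB heq with ⟨h1, h2⟩ | ⟨h1, h2⟩
  · rw [Nat.cast_zero] at h1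
    have hord : 0 < z.order := by
      by_contra hv
      have := mul_nonneg hs0.le (neg_nonneg.2 (not_lt.1 hv))
      linarith
    refine ⟨_, ?_, coeff_one_of_cancel hz hB hs.ne' hord.ne' heq (by simpa using h1) h2⟩
    refine div_pos ?_ hs0
    exact mul_pos_of_neg_of_neg (by linarith) (by linarith)
  -- Here the order is negative, so the constant `B` does not reach the leading term. The two other
  -- terms balance, and the residue `A c^(s-r-1)` equals `-z.order`.
  · rw [Nat.cast_zero, neg_zero] at h2
    have hv : z.order < 0 := by
      by_contra hv
      have := mul_nonneg (by linarith : (0 : ℚ) ≤ r + 1) (not_lt.1 hv)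
      linarith
    have hb : -(α : ℚ) + s * z.order < 0 := by
      have := mul_pos hs0 (neg_pos.2 hv)
      linarith
    obtain ⟨-, hL⟩ := coeff_pow_mul_hahnDeriv hz r
    obtain ⟨hR, hR'⟩ := HahnSeries.coeff_single_mul_zpow hz (-(α : ℚ)) A s
    rw [zpow_natCast] at hR hR'
    rw [zpow_natCast] at hR'
    rw [Int.cast_natCast] at hR hR'
    have hvF : (z.order : F) ≠ 0 := by exact_mod_cast hv.ne
    have hL0 : -(z.order : F) * z.leadingCoeff ^ (r + 1) ≠ 0 :=
      mul_ne_zero (neg_ne_zero.2 hvF) (pow_ne_zero _ hl)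
    rw [heq, HahnSeries.coeff_add, HahnSeries.coeff_single_of_ne (by
      rw [Nat.cast_zero, neg_zero]; linarith), add_zero] at hL
    have hab : (r + 1) * z.order + 1 = -(α : ℚ) + s * z.order := by
      refine le_antisymm h1 ?_
      by_contra hlt
      rw [hR _ (not_le.1 hlt)] at hL
      exact hL0 hL.symm
    rw [hab, hR'] at hL
    refine ⟨-z.order, by linarith, ?_⟩
    obtain ⟨-, hP⟩ := HahnSeries.coeff_single_mul_zpow hz (-(α : ℚ)) A ((s : ℤ) - r - 1)
    have h1' : -(α : ℚ) + (((s : ℤ) - r - 1 : ℤ) : ℚ) * z.order = 1 := by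
      push_cast; linarith
    rw [h1'] at hP
    rw [hP]
    apply mul_right_cancel₀ (pow_ne_zero (r + 1) hl)
    push_cast
    rw [← hL, mul_assoc]
    congr 1
    rw [← zpow_natCast _ (r + 1), ← zpow_add₀ hl, ← zpow_natCast _ s]
    congr 1; push_cast; ring

end RootAsymptotics

/-! ### The planar derivation on polynomials in `y` over a differential ring. -/

section PlanarDeriv

variable {A : Type*} [CommRing A]

/-- Coefficientwise application of an additive map to a polynomial. -/
noncomputable def coeffwise (D : A →+ A) (f : A[X]) : A[X] :=
  ∑ i ∈ Finset.range (f.natDegree + 1), monomial i (D (f.coeff i))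

theorem coeff_coeffwise (D : A →+ A) (f : A[X]) (i : ℕ) :
    (coeffwise D f).coeff i = D (f.coeff i) := by
  rw [coeffwise, finsetSum_coeff]
  simp only [coeff_monomial]
  rw [Finset.sum_ite_eq' (Finset.range (f.natDegree + 1))]
  split_ifs with h
  · rfl
  · rw [coeff_eq_zero_of_natDegree_lt (by simpa using h), map_zero]

theorem coeffwise_add (D : A →+ A) (f g : A[X]) :
    coeffwise D (f + g) = coeffwise D f + coeffwise D g := by
  ext i; simp [coeff_coeffwise]

theorem coeffwise_mul {D : A →+ A} (hD : IsLeibniz D) (f g : A[X]) :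
    coeffwise D (f * g) = f * coeffwise D g + g * coeffwise D f := by
  ext n
  rw [mul_comm g, coeff_coeffwise, coeff_add, coeff_mul, coeff_mul, coeff_mul, map_sum,
    ← Finset.sum_add_distrib]
  refine Finset.sum_congr rfl fun ij _ => ?_
  rw [hD, coeff_coeffwise, coeff_coeffwise, mul_comm (D _)]

theorem coeffwise_C (D : A →+ A) (a : A) : coeffwise D (C a) = C (D a) := by
  ext i
  rw [coeff_coeffwise, coeff_C, coeff_C]
  split_ifs <;> simp

theorem coeffwise_X {D : A →+ A} (hD : IsLeibniz D) : coeffwise D (X : A[X]) = 0 := by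
  ext i
  rw [coeff_coeffwise, coeff_X]
  split_ifs <;> simp [hD.map_one]

/-- The operator `y ^ r ∂ₓ + g ∂ᵧ` on `A[y]`, where `∂ₓ` acts on the coefficients through `D`. -/
noncomputable def planarDeriv (D : A →+ A) (r : ℕ) (g f : A[X]) : A[X] :=
  X ^ r * coeffwise D f + g * derivative f

theorem planarDeriv_add (D : A →+ A) (r : ℕ) (g f h : A[X]) :
    planarDeriv D r g (f + h) = planarDeriv D r g f + planarDeriv D r g h := by
  simp only [planarDeriv, coeffwise_add, derivative_add]; ring

theorem planarDeriv_mul {D : A →+ A} (hD : IsLeibniz D) (r : ℕ) (g f h : A[X]) :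
    planarDeriv D r g (f * h) = f * planarDeriv D r g h + h * planarDeriv D r g f := by
  simp only [planarDeriv, coeffwise_mul hD, derivative_mul]; ring

theorem planarDeriv_C (D : A →+ A) (r : ℕ) (g : A[X]) (a : A) :
    planarDeriv D r g (C a) = X ^ r * C (D a) := by
  simp only [planarDeriv, coeffwise_C, derivative_C, mul_zero, add_zero]

theorem planarDeriv_one {D : A →+ A} (hD : IsLeibniz D) (r : ℕ) (g : A[X]) :
    planarDeriv D r g 1 = 0 := by
  rw [← C_1, planarDeriv_C, hD.map_one, C_0, mul_zero]

theorem planarDeriv_X {D : A →+ A} (hD : IsLeibniz D) (r : ℕ) (g : A[X]) :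
    planarDeriv D r g X = g := by
  simp only [planarDeriv, coeffwise_X hD, derivative_X, mul_zero, zero_add, mul_one]

theorem planarDeriv_X_sub_C {D : A →+ A} (hD : IsLeibniz D) (r : ℕ) (g : A[X]) (z : A) :
    planarDeriv D r g (X - C z) = g - X ^ r * C (D z) := by
  rw [sub_eq_add_neg, ← C_neg, planarDeriv_add, planarDeriv_X hD, planarDeriv_C, map_neg, C_neg]
  ring

theorem planarDeriv_pow_succ {D : A →+ A} (hD : IsLeibniz D) (r : ℕ) (g f : A[X]) (n : ℕ) :
    planarDeriv D r g (f ^ (n + 1)) = (n + 1) * f ^ n * planarDeriv D r g f := by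
  induction n with
  | zero => simp
  | succ n ih =>
    rw [pow_succ, planarDeriv_mul hD, ih]
    push_cast
    ring

/-- Carries the relation `f ∣ d f` from coefficients in `k[x]` to coefficients in Hahn series. -/
theorem map_planarDeriv {A' : Type*} [CommRing A'] (D : A →+ A) (D' : A' →+ A') (φ : A →+* A')
    (hφ : ∀ a, D' (φ a) = φ (D a)) (r : ℕ) (g f : A[X]) :
    (planarDeriv D r g f).map φ = planarDeriv D' r (g.map φ) (f.map φ) := by
  have h : (coeffwise D f).map φ = coeffwise D' (f.map φ) := by
    ext i; simp [coeff_coeffwise, hφ]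
  simp only [planarDeriv, Polynomial.map_add, Polynomial.map_mul, Polynomial.map_pow, map_X, h,
    derivative_map]

end PlanarDeriv

/-! ### Roots and cofactors of Darboux polynomials. -/

section LogDerivative

variable {K : Type*} [Field K]

/-- A root of a Darboux polynomial solves the differential equation `z ^ r z' = g(z)`. -/
theorem eval_eq_of_isRoot_of_dvd_planarDeriv [CharZero K] {D : K →+ K} (hD : IsLeibniz D) (r : ℕ)
    (g f : K[X]) (hf : f ≠ 0) (hdvd : f ∣ planarDeriv D r g f) (z : K) (hz : f.IsRoot z) :
    z ^ r * D z = g.eval z := by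
  obtain ⟨n, hn⟩ : ∃ n, f.rootMultiplicity z = n + 1 :=
    ⟨f.rootMultiplicity z - 1, by have := (rootMultiplicity_pos hf).2 hz; omega⟩
  obtain ⟨h, hfh, hnd⟩ := exists_eq_pow_rootMultiplicity_mul_and_not_dvd f hf z
  rw [hn] at hfh
  have hp : (X - C z) ^ n ≠ 0 := pow_ne_zero _ (X_sub_C_ne_zero z)
  have h1 : (X - C z) ^ (n + 1) ∣ planarDeriv D r g f :=
    (Dvd.intro _ hfh.symm).trans hdvd
  rw [hfh, planarDeriv_mul hD, planarDeriv_pow_succ hD, planarDeriv_X_sub_C hD] at h1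
  have h2 := (dvd_add_right (Dvd.intro _ rfl)).1 h1
  -- Differentiating `(y - z)^(n + 1) h` leaves one term with only `n` visible factors `y - z`. The
  -- missing factor must come from `g - y^r z'`, as `h` is prime to `y - z`.
  have h3 : (X - C z) ∣ h * (((n : K[X]) + 1) * (g - X ^ r * C (D z))) := by
    rw [pow_succ, show h * (((n : K[X]) + 1) * (X - C z) ^ n * (g - X ^ r * C (D z))) =
      (X - C z) ^ n * (h * (((n : K[X]) + 1) * (g - X ^ r * C (D z)))) by ring] at h2
    exact (mul_dvd_mul_iff_left hp).1 h2
  have h4 := ((prime_X_sub_C z).dvd_or_dvd h3).resolve_left hnd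
  rw [dvd_iff_isRoot, IsRoot.def] at h4
  simp only [eval_mul, eval_add, eval_natCast, eval_one, eval_sub, eval_pow, eval_X, eval_C] at h4
  have hn0 : (n + 1 : K) ≠ 0 := by exact_mod_cast Nat.succ_ne_zero n
  exact (sub_eq_zero.1 ((mul_eq_zero.1 h4).resolve_left hn0)).symm

/-- Division by `y - z` from the constant term upwards, through the expansion of `1/(y - z)` in
powers of `y`. The coefficient at `j` then involves only the coefficients of `G` up to `j`. -/
theorem coeff_of_X_sub_C_mul_eq {z : K} (hz : z ≠ 0) {c G : K[X]} (h : (X - C z) * c = G) (j : ℕ) :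
    c.coeff j = -∑ i ∈ Finset.range (j + 1), G.coeff i * z ^ ((i : ℤ) - j - 1) := by
  induction j with
  | zero =>
    have h0 := congrArg (fun p => p.coeff 0) h
    simp only [sub_mul, coeff_sub, coeff_X_mul_zero, coeff_C_mul, zero_sub] at h0
    rw [Finset.sum_range_one, ← h0]
    simp only [Nat.cast_zero, zero_sub, sub_zero]
    rw [zpow_neg_one]
    field_simp
  | succ j ih =>
    have h0 := congrArg (fun p => p.coeff (j + 1)) h
    simp only [sub_mul, coeff_sub, coeff_X_mul, coeff_C_mul] at h0
    rw [Finset.sum_range_succ]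
    have h1 : ∑ i ∈ Finset.range (j + 1), G.coeff i * z ^ ((i : ℤ) - (j + 1 : ℕ) - 1) =
        z⁻¹ * ∑ i ∈ Finset.range (j + 1), G.coeff i * z ^ ((i : ℤ) - j - 1) := by
      rw [Finset.mul_sum]
      refine Finset.sum_congr rfl fun i _ => ?_
      rw [show (i : ℤ) - (j + 1 : ℕ) - 1 = ((i : ℤ) - j - 1) - 1 by push_cast; ring,
        zpow_sub_one₀ hz]
      ring
    rw [h1, ← neg_eq_iff_eq_neg.2 ih, ← h0, sub_self, zero_sub, zpow_neg_one]
    field_simp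
    ring

/-- The polynomial `(g - z' y ^ r) / (y - z)`. -/
noncomputable def rootCofactor (D : K →+ K) (r : ℕ) (g : K[X]) (z : K) : K[X] :=
  (g - X ^ r * C (D z)) /ₘ (X - C z)

theorem X_sub_C_mul_rootCofactor (D : K →+ K) (r : ℕ) (g : K[X]) (z : K)
    (hz : z ^ r * D z = g.eval z) :
    (X - C z) * rootCofactor D r g z = g - X ^ r * C (D z) := by
  rw [rootCofactor, mul_divByMonic_eq_iff_isRoot, IsRoot.def, eval_sub, eval_mul,
    eval_pow, eval_X, eval_C, hz, sub_self]

theorem planarDeriv_prod_X_sub_C {D : K →+ K} (hD : IsLeibniz D) (r : ℕ) (g : K[X]) (S : Multiset K)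
    (hS : ∀ z ∈ S, z ^ r * D z = g.eval z) :
    planarDeriv D r g (S.map fun z => X - C z).prod =
      (S.map fun z => X - C z).prod * (S.map (rootCofactor D r g)).sum := by
  induction S using Multiset.induction_on with
  | empty => simp [planarDeriv_one hD]
  | cons z S ih =>
    rw [Multiset.map_cons, Multiset.prod_cons, planarDeriv_mul hD, Multiset.map_cons,
      Multiset.sum_cons, ih fun w hw => hS w (Multiset.mem_cons_of_mem hw), planarDeriv_X_sub_C hD,
      ← X_sub_C_mul_rootCofactor D r g z (hS z (Multiset.mem_cons_self z S))]
    ring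

/-- The cofactor of a split Darboux polynomial. -/
theorem cofactor_eq_of_splits [CharZero K] {D : K →+ K} (hD : IsLeibniz D) (r : ℕ) (g f l : K[X])
    (hf : f ≠ 0) (hsplit : f.Splits) (hl : planarDeriv D r g f = f * l) :
    l = X ^ r * C (D f.leadingCoeff / f.leadingCoeff) + (f.roots.map (rootCofactor D r g)).sum := by
  have hroot : ∀ z ∈ f.roots, z ^ r * D z = g.eval z := fun z hz =>
    eval_eq_of_isRoot_of_dvd_planarDeriv hD r g f hf ⟨l, hl⟩ z (isRoot_of_mem_roots hz)
  have hlc : f.leadingCoeff ≠ 0 := leadingCoeff_ne_zero.2 hf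
  have hfac := hsplit.eq_prod_roots
  apply mul_left_cancel₀ hf
  rw [← hl]
  conv_lhs => rw [hfac]
  rw [planarDeriv_mul hD, planarDeriv_prod_X_sub_C hD r g _ hroot, planarDeriv_C]
  conv_rhs => rw [hfac]
  have hC : C (D f.leadingCoeff) = C f.leadingCoeff * C (D f.leadingCoeff / f.leadingCoeff) := by
    rw [← C_mul, mul_div_cancel₀ _ hlc]
  have hlc' : (C f.leadingCoeff * (f.roots.map fun a => X - C a).prod).leadingCoeff =
      f.leadingCoeff := by rw [← hfac]
  have hr' : (C f.leadingCoeff * (f.roots.map fun a => X - C a).prod).roots = f.roots := by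
    rw [← hfac]
  rw [hlc', hr', hC]
  ring

/-- Only `b` and `z' y^r` enter up to degree `r`. Substituting `z' = z^(-r) (a z^s + b)` cancels
`b`. -/
theorem coeff_rootCofactor_of_lt (D : K →+ K) {r s : ℕ} (hrs : r < s) (a b z : K)
    (hz : z ≠ 0) (heq : z ^ r * D z = a * z ^ s + b) :
    (rootCofactor D r (C a * X ^ s + C b) z).coeff r = a * z ^ ((s : ℤ) - r - 1) := by
  have hmul := X_sub_C_mul_rootCofactor D r (C a * X ^ s + C b) z (by simpa using heq)
  have hsum : ∑ i ∈ Finset.range (r + 1),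
      (C a * X ^ s + C b - X ^ r * C (D z)).coeff i * z ^ ((i : ℤ) - r - 1) =
      b * z ^ (-(r : ℤ) - 1) - D z * z ^ (-1 : ℤ) := by
    have : ∀ i ∈ Finset.range (r + 1),
        (C a * X ^ s + C b - X ^ r * C (D z)).coeff i * z ^ ((i : ℤ) - r - 1) =
        (if i = 0 then b * z ^ (-(r : ℤ) - 1) else 0) -
          (if i = r then D z * z ^ (-1 : ℤ) else 0) := by
      intro i hi
      have hi' : i ≠ s := by have := Finset.mem_range.1 hi; omega
      rw [mul_comm (X ^ r) _, coeff_sub, coeff_add, coeff_C_mul_X_pow, coeff_C, coeff_C_mul_X_pow,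
        if_neg hi', zero_add, sub_mul]
      congr 1
      · split_ifs with h
        · subst h; simp
        · simp
      · split_ifs with h
        · subst h; simp
        · simp
    rw [Finset.sum_congr rfl this, Finset.sum_sub_distrib,
      Finset.sum_ite_eq' (Finset.range (r + 1)), Finset.sum_ite_eq' (Finset.range (r + 1))]
    simp
  rw [coeff_of_X_sub_C_mul_eq hz hmul, hsum]
  have hzr : z ^ (r + 1) ≠ 0 := pow_ne_zero _ hz
  apply mul_right_cancel₀ hzr
  have e1 : z ^ (-(r : ℤ) - 1) * z ^ (r + 1) = 1 := by
    rw [← zpow_natCast z (r + 1), ← zpow_add₀ hz]; push_cast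
    rw [show -(r : ℤ) - 1 + (r + 1) = 0 by ring, zpow_zero]
  have e2 : z ^ ((s : ℤ) - r - 1) * z ^ (r + 1) = z ^ s := by
    rw [← zpow_natCast z (r + 1), ← zpow_add₀ hz, ← zpow_natCast z s]; push_cast
    congr 1; ring
  have e3 : z ^ (-1 : ℤ) * z ^ (r + 1) = z ^ r := by
    rw [zpow_neg_one, pow_succ]; field_simp
  linear_combination (-b) * e1 - a * e2 + D z * e3 + heq

/-- Below degree `r` the term `z' y^r` does not enter, so these coefficients involve only negative
powers of `z`. -/
theorem coeff_rootCofactor_of_le (D : K →+ K) {r s : ℕ} (hs : 0 < s) (a b z : K)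
    (hz : z ≠ 0) (heq : z ^ r * D z = a * z ^ s + b) {j : ℕ} (hj : j < r) :
    (rootCofactor D r (C a * X ^ s + C b) z).coeff j =
      -(b * z ^ (-((j + 1 : ℕ) : ℤ)) +
        if s ≤ j then a * z ^ (-((j + 1 - s : ℕ) : ℤ)) else 0) := by
  have hmul := X_sub_C_mul_rootCofactor D r (C a * X ^ s + C b) z (by simpa using heq)
  rw [coeff_of_X_sub_C_mul_eq hz hmul]
  congr 1
  have : ∀ i ∈ Finset.range (j + 1),
      (C a * X ^ s + C b - X ^ r * C (D z)).coeff i * z ^ ((i : ℤ) - j - 1) =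
      (if i = 0 then b * z ^ (-((j + 1 : ℕ) : ℤ)) else 0) +
        (if i = s then a * z ^ ((s : ℤ) - j - 1) else 0) := by
    intro i hi
    have hi' : i ≠ r := by have := Finset.mem_range.1 hi; omega
    rw [mul_comm (X ^ r) _, coeff_sub, coeff_add, coeff_C_mul_X_pow, coeff_C, coeff_C_mul_X_pow,
      if_neg hi', sub_zero, add_comm, add_mul]
    congr 1
    · split_ifs with h
      · subst h
        congr 2; push_cast; ring
      · simp
    · split_ifs with h
      · subst h; simp
      · simp
  rw [Finset.sum_congr rfl this, Finset.sum_add_distrib, Finset.sum_ite_eq' (Finset.range (j + 1)),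
    Finset.sum_ite_eq' (Finset.range (j + 1))]
  congr 1
  · simp
  · by_cases h : s ≤ j
    · rw [if_pos (Finset.mem_range.2 (by omega)), if_pos h]
      congr 2; rw [Nat.cast_sub (by omega)]; push_cast; ring
    · rw [if_neg (fun h' => h (by have := Finset.mem_range.1 h'; omega)), if_neg h]

end LogDerivative

/-! ### Expansion of `k[x]` at infinity. -/

section ExpandAtInfinity

variable {k : Type*} [Field k] (F : Type*) [Field F] [Algebra k F]

/-- Expansion at infinity: `k[x] → F⟦ℚ⟧`, sending `x` to `t⁻¹`. -/
noncomputable def expandAtInfinity : k[X] →+* HahnSeries ℚ F :=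
  eval₂RingHom ((HahnSeries.C : F →+* HahnSeries ℚ F).comp (algebraMap k F))
    (HahnSeries.single (-1) 1)

theorem expandAtInfinity_C_mul_X_pow (a : k) (n : ℕ) :
    expandAtInfinity F (C a * X ^ n) = HahnSeries.single (-(n : ℚ)) (algebraMap k F a) := by
  rw [expandAtInfinity, coe_eval₂RingHom, eval₂_mul, eval₂_C, eval₂_X_pow, HahnSeries.single_pow,
    one_pow, RingHom.comp_apply, HahnSeries.C_apply, HahnSeries.single_mul_single, mul_one,
    zero_add, nsmul_eq_mul, mul_neg_one]

theorem coeff_expandAtInfinity (p : k[X]) (q : ℚ) :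
    (expandAtInfinity F p).coeff q =
      ∑ n ∈ Finset.range (p.natDegree + 1),
        if q = -(n : ℚ) then algebraMap k F (p.coeff n) else 0 := by
  conv_lhs => rw [p.as_sum_range_C_mul_X_pow, map_sum]
  rw [HahnSeries.coeff_sum]
  refine Finset.sum_congr rfl fun n _ => ?_
  rw [expandAtInfinity_C_mul_X_pow, HahnSeries.coeff_single]
  split_ifs <;> simp_all

/-- Used at `q = 1`: a polynomial has no residue at infinity, which is the obstruction to Darboux
polynomials. -/
theorem coeff_expandAtInfinity_of_pos (p : k[X]) {q : ℚ} (hq : 0 < q) :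
    (expandAtInfinity F p).coeff q = 0 := by
  rw [coeff_expandAtInfinity]
  refine Finset.sum_eq_zero fun n _ => if_neg fun h => ?_
  have : (0 : ℚ) ≤ n := Nat.cast_nonneg n
  linarith

theorem coeff_expandAtInfinity_neg_natDegree (p : k[X]) :
    (expandAtInfinity F p).coeff (-(p.natDegree : ℚ)) = algebraMap k F p.leadingCoeff := by
  rw [coeff_expandAtInfinity, Finset.sum_eq_single p.natDegree]
  · simp
  · intro n _ hn
    rw [if_neg]
    intro h
    exact hn (by exact_mod_cast (neg_injective h).symm)
  · simp

theorem expandAtInfinity_injective : Function.Injective (expandAtInfinity (k := k) F) := by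
  rw [injective_iff_map_eq_zero]
  intro p hp
  have h := coeff_expandAtInfinity_neg_natDegree F p
  rw [hp, HahnSeries.coeff_zero, eq_comm, map_eq_zero] at h
  exact leadingCoeff_eq_zero.1 h

theorem order_expandAtInfinity {p : k[X]} (hp : p ≠ 0) :
    (expandAtInfinity F p).order = -(p.natDegree : ℚ) := by
  have hne : expandAtInfinity F p ≠ 0 :=
    (map_ne_zero_iff _ (expandAtInfinity_injective F)).2 hp
  have hc : (expandAtInfinity F p).coeff (-(p.natDegree : ℚ)) ≠ 0 := by
    rw [coeff_expandAtInfinity_neg_natDegree, Ne, map_eq_zero]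
    exact leadingCoeff_ne_zero.2 hp
  refine le_antisymm (HahnSeries.order_le_of_coeff_ne_zero hc) ?_
  rw [HahnSeries.le_order_iff_forall hne]
  intro q hq
  rw [coeff_expandAtInfinity]
  refine Finset.sum_eq_zero fun n hn => if_neg fun h => ?_
  have : (n : ℚ) ≤ p.natDegree := by exact_mod_cast Finset.mem_range_succ_iff.1 hn
  linarith

theorem hahnDeriv_expandAtInfinity [CharZero F] (p : k[X]) :
    hahnDeriv F (expandAtInfinity F p) = expandAtInfinity F (derivative p) := by
  induction p using Polynomial.induction_on' with
  | add p q hp hq => rw [map_add, map_add, hp, hq, derivative_add, map_add]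
  | monomial n a =>
    rw [← C_mul_X_pow_eq_monomial, expandAtInfinity_C_mul_X_pow, hahnDeriv_single,
      derivative_C_mul_X_pow, expandAtInfinity_C_mul_X_pow]
    rcases n with _ | n
    · simp
    · congr 1
      · simp
      · simp; ring

theorem expandAtInfinity_mem_puiseuxSubfield (p : k[X]) :
    expandAtInfinity F p ∈ puiseuxSubfield F := by
  rw [p.as_sum_range_C_mul_X_pow, map_sum]
  refine sum_mem fun n _ => ?_
  rw [expandAtInfinity_C_mul_X_pow]
  exact single_mem_puiseuxSubfield _ _

/-- The splitting takes place over Puiseux series and is then viewed in the full Hahn field, where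
`hahnDeriv` acts. No stability of the subfield under differentiation is needed. -/
theorem splits_map_expandAtInfinity [IsAlgClosed F] [CharZero F] (f : k[X][X]) :
    (f.map (expandAtInfinity F)).Splits := by
  have := isAlgClosed_puiseuxSubfield (F := F)
  let φ : k[X] →+* puiseuxSubfield F := (expandAtInfinity F).codRestrict _
    (expandAtInfinity_mem_puiseuxSubfield F)
  have h : (puiseuxSubfield F).subtype.comp φ = expandAtInfinity F := by ext <;> rfl
  rw [← h, ← Polynomial.map_map]
  exact (IsAlgClosed.splits (f.map φ)).map _

end ExpandAtInfinity

/-! ### Darboux polynomials have degree zero in `y`: residue arguments. -/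

section NoDarboux

variable {k : Type*} [Field k]

/-- The polynomial `A x ^ α y ^ s + B x ^ β` in `k[x][y]`. -/
noncomputable def planarBinomial (A : k) (α s : ℕ) (B : k) (β : ℕ) : k[X][X] :=
  C (C A * X ^ α) * X ^ s + C (C B * X ^ β)

theorem map_planarBinomial (F : Type*) [Field F] [Algebra k F] (A : k) (α s : ℕ) (B : k) (β : ℕ) :
    (planarBinomial A α s B β).map (expandAtInfinity F) =
      C (HahnSeries.single (-(α : ℚ)) (algebraMap k F A)) * X ^ s +
        C (HahnSeries.single (-(β : ℚ)) (algebraMap k F B)) := by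
  simp only [planarBinomial, Polynomial.map_add, Polynomial.map_mul, Polynomial.map_pow, map_X,
    map_C, expandAtInfinity_C_mul_X_pow]

theorem planarDeriv_map_expandAtInfinity (F : Type*) [Field F] [CharZero F] [Algebra k F] (r : ℕ)
    (g f : k[X][X]) :
    (planarDeriv derivative.toAddMonoidHom r g f).map (expandAtInfinity F) =
      planarDeriv (hahnDeriv F) r (g.map (expandAtInfinity F)) (f.map (expandAtInfinity F)) :=
  map_planarDeriv _ _ _ (fun p => hahnDeriv_expandAtInfinity F p) r g f

theorem map_expandAtInfinity_ne_zero (F : Type*) [Field F] [Algebra k F] {f : k[X][X]}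
    (hf : f ≠ 0) : f.map (expandAtInfinity F) ≠ 0 :=
  (Polynomial.map_ne_zero_iff (expandAtInfinity_injective F)).2 hf

theorem ne_zero_and_eq_of_mem_roots (F : Type*) [Field F] [CharZero F] [Algebra k F]
    {r α s β : ℕ} {A B : k} (hB : B ≠ 0) (hs : 0 < s) {f : k[X][X]} (hf : f ≠ 0)
    (hdvd : f ∣ planarDeriv derivative.toAddMonoidHom r (planarBinomial A α s B β) f)
    (z : HahnSeries ℚ F) (hz : z ∈ (f.map (expandAtInfinity F)).roots) :
    z ≠ 0 ∧ z ^ r * hahnDeriv F z = HahnSeries.single (-(α : ℚ)) (algebraMap k F A) * z ^ s +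
      HahnSeries.single (-(β : ℚ)) (algebraMap k F B) := by
  have hchar : CharZero (HahnSeries ℚ F) := charZero_of_injective_ringHom HahnSeries.C_injective
  have hd := Polynomial.map_dvd (expandAtInfinity F) hdvd
  rw [planarDeriv_map_expandAtInfinity, map_planarBinomial] at hd
  have h := eval_eq_of_isRoot_of_dvd_planarDeriv (isLeibniz_hahnDeriv (F := F)) r _ _
    (map_expandAtInfinity_ne_zero F hf) hd z (isRoot_of_mem_roots hz)
  simp only [eval_add, eval_mul, eval_C, eval_pow, eval_X] at h
  refine ⟨?_, h⟩
  rintro rfl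
  rw [map_zero, mul_zero, zero_pow hs.ne', mul_zero, zero_add, eq_comm,
    HahnSeries.single_eq_zero_iff, map_eq_zero] at h
  exact hB h

theorem Polynomial.coeff_multiset_map_sum {ι R : Type*} [CommRing R] (S : Multiset ι)
    (c : ι → R[X]) (n : ℕ) : (S.map c).sum.coeff n = (S.map fun z => (c z).coeff n).sum := by
  induction S using Multiset.induction_on with
  | empty => simp
  | cons z S ih => simp [ih]

theorem HahnSeries.coeff_multiset_map_sum {ι F : Type*} [Field F] (S : Multiset ι)
    (c : ι → HahnSeries ℚ F) (q : ℚ) :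
    (S.map c).sum.coeff q = (S.map fun z => (c z).coeff q).sum := by
  induction S using Multiset.induction_on with
  | empty => simp
  | cons z S ih => simp [ih]

theorem HahnSeries.order_multiset_prod {F : Type*} [Field F] (S : Multiset (HahnSeries ℚ F)) (v : ℚ)
    (hS : ∀ z ∈ S, z ≠ 0 ∧ z.order = v) : S.prod ≠ 0 ∧ S.prod.order = S.card * v := by
  induction S using Multiset.induction_on with
  | empty => simp
  | cons z S ih =>
    obtain ⟨h1, h2⟩ := ih fun w hw => hS w (Multiset.mem_cons_of_mem hw)
    obtain ⟨h3, h4⟩ := hS z (Multiset.mem_cons_self z S)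
    rw [Multiset.prod_cons]
    refine ⟨mul_ne_zero h3 h1, ?_⟩
    rw [HahnSeries.order_mul h3 h1, h2, h4, Multiset.card_cons]
    push_cast; ring

theorem coeff_one_hahnDeriv_div {F : Type*} [Field F] [CharZero F] {z : HahnSeries ℚ F}
    (hz : z ≠ 0) : (hahnDeriv F z / z).coeff 1 = -(z.order : F) := by
  obtain ⟨w, hw, h⟩ := exists_hahnDeriv_eq_mul hz
  rw [h, mul_div_cancel_left₀ _ hz, HahnSeries.coeff_single_mul_self, one_mul,
    (HahnSeries.coeff_zero_add_of_pos _ hw).2]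

variable [CharZero k]

/-- Degree relations for a Darboux polynomial of
`y ^ r ∂ₓ + (A x ^ α y ^ s + B x ^ β) ∂ᵧ` with `r < s`. -/
theorem natDegree_relations_of_dvd_planarDeriv {r α s β : ℕ} {A B : k} (hA : A ≠ 0) (hB : B ≠ 0)
    (hrs : r < s) (hαβ : α ≠ β) {f : k[X][X]} (hf : f ≠ 0)
    (hdvd : f ∣ planarDeriv derivative.toAddMonoidHom r (planarBinomial A α s B β) f) :
    (f.leadingCoeff.natDegree : ℚ) +
      f.natDegree * (((β : ℚ) - α) / s * (s - r - 1) / s) = 0 ∧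
    (0 : ℚ) ≤ f.leadingCoeff.natDegree + f.natDegree * (((β : ℚ) - α) / s) := by
  let F := AlgebraicClosure k
  have : CharZero F := charZero_of_injective_algebraMap (algebraMap k F).injective
  have hchar : CharZero (HahnSeries ℚ F) := charZero_of_injective_ringHom HahnSeries.C_injective
  have hA' : algebraMap k F A ≠ 0 := by simpa using hA
  have hB' : algebraMap k F B ≠ 0 := by simpa using hB
  have hs : 0 < s := by omega
  have hinj := expandAtInfinity_injective (k := k) F
  set f' := f.map (expandAtInfinity F) with hf'
  have hf0 : f' ≠ 0 := map_expandAtInfinity_ne_zero F hf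
  have hsplit : f'.Splits := splits_map_expandAtInfinity F f
  have hcard : f'.roots.card = f.natDegree := by
    rw [← hsplit.natDegree_eq_card_roots, hf', natDegree_map_eq_of_injective hinj]
  have hlead : f'.leadingCoeff = expandAtInfinity F f.leadingCoeff :=
    leadingCoeff_map_of_injective hinj f
  have hlc0 : f.leadingCoeff ≠ 0 := leadingCoeff_ne_zero.2 hf
  have hlc0' : f'.leadingCoeff ≠ 0 := leadingCoeff_ne_zero.2 hf0
  have hroots := ne_zero_and_eq_of_mem_roots F hB hs hf hdvd
  have hasym : ∀ z ∈ f'.roots, _ := fun z hz =>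
    order_and_coeff_one_of_lt (hroots z hz).1 hA' hB' hrs hαβ (hroots z hz).2
  constructor
  · obtain ⟨l, hl⟩ := hdvd
    have hl' := congrArg (Polynomial.map (expandAtInfinity F)) hl
    rw [planarDeriv_map_expandAtInfinity, map_planarBinomial, Polynomial.map_mul, ← hf'] at hl'
    have hco := cofactor_eq_of_splits (isLeibniz_hahnDeriv (F := F)) r _ f' _ hf0 hsplit hl'
    -- Take the `x⁻¹` coefficient of the coefficient of `y^r`: `c'/c` contributes the degree of the
    -- leading coefficient `c`, and every root the same rational number.
    have hco := congrArg (fun p => (p.coeff r).coeff 1) hco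
    rw [coeff_map, coeff_expandAtInfinity_of_pos F _ one_pos, coeff_add, mul_comm (X ^ r),
      coeff_C_mul_X_pow, if_pos rfl, HahnSeries.coeff_add, coeff_one_hahnDeriv_div hlc0',
      Polynomial.coeff_multiset_map_sum, HahnSeries.coeff_multiset_map_sum, hlead,
      order_expandAtInfinity F hlc0,
      Multiset.map_congr rfl (g := fun _ => ((((β : ℚ) - α) / s * (s - r - 1) / s : ℚ) : F))
        (fun z hz => by
          rw [coeff_rootCofactor_of_lt _ hrs _ _ z (hroots z hz).1 (hroots z hz).2,
            (hasym z hz).2]),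
      Multiset.map_const', Multiset.sum_replicate, hcard, nsmul_eq_mul] at hco
    have hq : (((f.leadingCoeff.natDegree : ℚ) +
      f.natDegree * (((β : ℚ) - α) / s * (s - r - 1) / s) : ℚ) : F) = 0 := by
      push_cast at hco ⊢
      rw [hco]; ring
    exact_mod_cast hq
  -- The inequality says that `f(x, 0)`, the leading coefficient times the product of the negated
  -- roots, has nonnegative degree.
  · have hc0 : expandAtInfinity F (f.coeff 0) =
        f'.leadingCoeff * (f'.roots.map fun z => -z).prod := by
      have h := congrArg (fun p => p.coeff 0) hsplit.eq_prod_roots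
      rw [hf', coeff_map] at h
      rw [h, ← hf', coeff_C_mul, coeff_zero_eq_eval_zero, eval_multiset_prod, Multiset.map_map]
      simp
    obtain ⟨h1, h2⟩ := HahnSeries.order_multiset_prod (f'.roots.map fun z => -z)
      (((α : ℚ) - β) / s) (by
        intro w hw
        obtain ⟨z, hz, rfl⟩ := Multiset.mem_map.1 hw
        exact ⟨neg_ne_zero.2 (hroots z hz).1, by rw [HahnSeries.order_neg]; exact (hasym z hz).1⟩)
    have hne : f.coeff 0 ≠ 0 := by
      intro h
      rw [h, map_zero] at hc0
      exact mul_ne_zero hlc0' h1 hc0.symm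
    have ho := congrArg HahnSeries.order hc0
    rw [order_expandAtInfinity F hne, HahnSeries.order_mul hlc0' h1, h2, hlead,
      order_expandAtInfinity F hlc0, Multiset.card_map, hcard] at ho
    have h0 : (0 : ℚ) ≤ (f.coeff 0).natDegree := Nat.cast_nonneg _
    have : (f.natDegree : ℚ) * (((β : ℚ) - α) / s) = -(f.natDegree * (((α : ℚ) - β) / s)) := by
      ring
    linarith

/-- Let `D` be the degree of the leading coefficient, `n` the `y`-degree and `m = (α - β)/s`. The
relations read `D = n m (s - r - 1)/s` and `D ≥ n m`. If `m > 0` they conflict unless `n = 0`. If `m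
< 0` and `r + 1 < s`, the first alone forces `n = 0`, as `D ≥ 0`. -/
theorem natDegree_eq_zero_of_dvd_planarDeriv_of_lt {r α s β : ℕ} {A B : k} (hA : A ≠ 0)
    (hB : B ≠ 0) (hrs : r < s) (hαβ : β < α ∨ α < β ∧ r + 1 < s) {f : k[X][X]} (hf : f ≠ 0)
    (hdvd : f ∣ planarDeriv derivative.toAddMonoidHom r (planarBinomial A α s B β) f) :
    f.natDegree = 0 := by
  obtain ⟨h1, h2⟩ := natDegree_relations_of_dvd_planarDeriv hA hB hrs (by omega) hf hdvd
  have hs : (0 : ℚ) < s := by exact_mod_cast (by omega : 0 < s)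
  have hl : (0 : ℚ) ≤ f.leadingCoeff.natDegree := Nat.cast_nonneg _
  by_contra hn
  have hn' : (0 : ℚ) < f.natDegree := by exact_mod_cast Nat.pos_of_ne_zero hn
  rcases hαβ with h | ⟨h, hr⟩
  · have hlt : (β : ℚ) < α := by exact_mod_cast h
    have hm : 0 < ((α : ℚ) - β) / s := div_pos (by linarith) hs
    have hpos : 0 < (f.natDegree : ℚ) * (((α : ℚ) - β) / s * ((r + 1) / s)) := by positivity
    have e : (f.natDegree : ℚ) * (((β : ℚ) - α) / s * (s - r - 1) / s) =
        f.natDegree * (((β : ℚ) - α) / s) + f.natDegree * (((α : ℚ) - β) / s * ((r + 1) / s)) := by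
      field_simp; ring
    linarith
  · have hlt : (α : ℚ) < β := by exact_mod_cast h
    have hr' : (r : ℚ) + 1 < s := by exact_mod_cast hr
    have hm : 0 < ((β : ℚ) - α) / s := div_pos (by linarith) hs
    have : 0 < (f.natDegree : ℚ) * (((β : ℚ) - α) / s * (s - r - 1) / s) :=
      mul_pos hn' (div_pos (mul_pos hm (by linarith)) hs)
    linarith

/-- The residues live in an unordered field, so positivity is tracked through rational
representatives. -/
theorem exists_multiset_sum_eq_ratCast {ι F : Type*} [Field F] [CharZero F] (S : Multiset ι)
    (c : ι → F) (hc : ∀ z ∈ S, ∃ q : ℚ, 0 < q ∧ c z = q) :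
    ∃ q : ℚ, 0 ≤ q ∧ (S ≠ 0 → 0 < q) ∧ (S.map c).sum = q := by
  induction S using Multiset.induction_on with
  | empty => exact ⟨0, by simp⟩
  | cons z S ih =>
    obtain ⟨q, hq, -, h⟩ := ih fun w hw => hc w (Multiset.mem_cons_of_mem hw)
    obtain ⟨q', hq', h'⟩ := hc z (Multiset.mem_cons_self z S)
    refine ⟨q' + q, by linarith, fun _ => by linarith, ?_⟩
    rw [Multiset.map_cons, Multiset.sum_cons, h, h']
    push_cast; rfl

theorem natDegree_eq_zero_of_dvd_planarDeriv_of_le {r α s : ℕ} {A B : k} (hA : A ≠ 0)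
    (hB : B ≠ 0) (hs : 0 < s) (hsr : s ≤ r) (hα : 0 < α) {f : k[X][X]} (hf : f ≠ 0)
    (hdvd : f ∣ planarDeriv derivative.toAddMonoidHom r (planarBinomial A α s B 0) f) :
    f.natDegree = 0 := by
  let F := AlgebraicClosure k
  have : CharZero F := charZero_of_injective_algebraMap (algebraMap k F).injective
  have hchar : CharZero (HahnSeries ℚ F) := charZero_of_injective_ringHom HahnSeries.C_injective
  have hA' : algebraMap k F A ≠ 0 := by simpa using hA
  have hB' : algebraMap k F B ≠ 0 := by simpa using hB
  have hinj := expandAtInfinity_injective (k := k) F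
  set f' := f.map (expandAtInfinity F) with hf'
  have hf0 : f' ≠ 0 := map_expandAtInfinity_ne_zero F hf
  have hsplit : f'.Splits := splits_map_expandAtInfinity F f
  have hcard : f'.roots.card = f.natDegree := by
    rw [← hsplit.natDegree_eq_card_roots, hf', natDegree_map_eq_of_injective hinj]
  have hroots := ne_zero_and_eq_of_mem_roots F hB hs hf hdvd
  obtain ⟨l, hl⟩ := hdvd
  have hl' := congrArg (Polynomial.map (expandAtInfinity F)) hl
  rw [planarDeriv_map_expandAtInfinity, map_planarBinomial, Polynomial.map_mul, ← hf'] at hl'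
  have hco := cofactor_eq_of_splits (isLeibniz_hahnDeriv (F := F)) r _ f' _ hf0 hsplit hl'
  set a : HahnSeries ℚ F := HahnSeries.single (-(α : ℚ)) (algebraMap k F A) with ha
  set b : HahnSeries ℚ F := HahnSeries.single (-((0 : ℕ) : ℚ)) (algebraMap k F B) with hb
  set P : Subring (HahnSeries ℚ F) := (expandAtInfinity (k := k) F).range with hP
  have haP : a ∈ P := ⟨C A * X ^ α, expandAtInfinity_C_mul_X_pow F A α⟩
  -- As `β = 0`, `b` is a nonzero constant, so the recurrence below can be solved within the
  -- polynomials.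
  have hbP : ∃ b' ∈ P, b' * b = 1 := by
    refine ⟨expandAtInfinity F (C B⁻¹ * X ^ 0), ⟨_, rfl⟩, ?_⟩
    rw [expandAtInfinity_C_mul_X_pow, hb, HahnSeries.single_mul_single, ← map_mul,
      inv_mul_cancel₀ hB, map_one]
    simp
  -- Negative power sums of the roots. The cofactor coefficients at `j < r` give a recurrence
  -- showing that `q 1, ..., q r` are polynomials in `x`.
  let q : ℕ → HahnSeries ℚ F := fun j => (f'.roots.map fun z => z ^ (-(j : ℤ))).sum
  have hrec : ∀ j < r, -(b * q (j + 1) + if s ≤ j then a * q (j + 1 - s) else 0) ∈ P := by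
    intro j hj
    have h := congrArg (fun p => p.coeff j) hco
    rw [coeff_map, coeff_add, mul_comm (X ^ r), coeff_C_mul_X_pow, if_neg hj.ne, zero_add,
      Polynomial.coeff_multiset_map_sum,
      Multiset.map_congr rfl (g := fun z => -(b * z ^ (-((j + 1 : ℕ) : ℤ)) +
        if s ≤ j then a * z ^ (-((j + 1 - s : ℕ) : ℤ)) else 0)) (fun z hz =>
          coeff_rootCofactor_of_le _ hs _ _ z (hroots z hz).1 (hroots z hz).2 hj)] at h
    refine ⟨l.coeff j, ?_⟩
    rw [h, Multiset.sum_map_neg, Multiset.sum_map_add, Multiset.sum_map_mul_left]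
    congr 2
    split_ifs with hsj
    · rw [Multiset.sum_map_mul_left]
    · simp
  have hqP : ∀ j, j < r → q (j + 1) ∈ P := by
    intro j
    induction j using Nat.strong_induction_on with
    | _ j ih =>
      intro hj
      obtain ⟨b', hb', hbb⟩ := hbP
      have h := hrec j hj
      have h2 : b * q (j + 1) ∈ P := by
        split_ifs at h with hsj
        · have h3 : a * q (j + 1 - s) ∈ P := by
            have := ih (j - s) (by omega) (by omega)
            rw [show j - s + 1 = j + 1 - s by omega] at this
            exact mul_mem haP this
          have := neg_mem (add_mem h h3)
          convert this using 1
          ring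
        · have := neg_mem h
          rwa [neg_neg, add_zero] at this
      have h4 := mul_mem hb' h2
      rwa [← mul_assoc, hbb, one_mul] at h4
  -- The exponent is chosen so that each summand is `a z^(s - r - 1)`, whose `x⁻¹` coefficient is a
  -- positive rational.
  have hfin : a * q (r - s + 1) ∈ P := mul_mem haP (hqP (r - s) (by omega))
  obtain ⟨p, hp⟩ := hfin
  have h0 := coeff_expandAtInfinity_of_pos F p one_pos
  rw [hp, ← Multiset.sum_map_mul_left, HahnSeries.coeff_multiset_map_sum] at h0
  obtain ⟨t, -, ht, hsum⟩ := exists_multiset_sum_eq_ratCast f'.roots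
    (fun z => (a * z ^ (-((r - s + 1 : ℕ) : ℤ))).coeff 1) (fun z hz => by
      rw [show (-((r - s + 1 : ℕ) : ℤ)) = (s : ℤ) - r - 1 by
        rw [Nat.cast_add, Nat.cast_sub hsr]; push_cast; ring]
      exact exists_pos_coeff_one_of_le (hroots z hz).1 hA' hB' hs hsr hα (hroots z hz).2)
  rw [h0] at hsum
  have ht0 : t = 0 := by exact_mod_cast hsum.symm
  by_contra hn
  have hne : f'.roots ≠ 0 := by
    intro h
    rw [h, Multiset.card_zero] at hcard
    exact hn hcard.symm
  exact (ht hne).ne' ht0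

end NoDarboux

/-! ### Polynomial solutions of `p' = A x^α p + B x^β`. -/

section LinearEquation

variable {k : Type*} [Field k]

theorem coeff_X_pow_mul_binomial_eq {A B : k} {α β : ℕ} {p : k[X]}
    (h : derivative p = C A * X ^ α * p + C B * X ^ β) (j : ℕ) :
    p.coeff (j + 1) * (j + 1) =
      (if α ≤ j then A * p.coeff (j - α) else 0) + if j = β then B else 0 := by
  have h1 := congrArg (fun q => q.coeff j) h
  rw [mul_assoc] at h1
  simp only [coeff_derivative, coeff_add, coeff_C_mul, coeff_X_pow_mul', coeff_X_pow, mul_ite,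
    mul_one, mul_zero] at h1
  exact h1

/-- The equation `p' = A x ^ α p + B x ^ β` has no polynomial solution unless
`α + 1 ∣ β - α`. -/
theorem no_polynomial_solution [CharZero k] {A B : k} (hA : A ≠ 0) (hB : B ≠ 0) {α β : ℕ}
    (hαβ : α < β) (hdvd : ¬ (α + 1) ∣ (β - α)) (p : k[X]) :
    derivative p ≠ C A * X ^ α * p + C B * X ^ β := by
  intro h
  have hrec := coeff_X_pow_mul_binomial_eq h
  -- The recurrence links indices differing by `α + 1`, and the inhomogeneous term first enters at
  -- index `β + 1`. But the top-degree comparison forces degree `β - α`, an index where this makes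
  -- the coefficient zero.
  have hzero : ∀ i, i < β + 1 → ¬ (α + 1) ∣ i → p.coeff i = 0 := by
    intro i
    induction i using Nat.strong_induction_on with
    | _ i ih =>
      intro hi hnd
      obtain ⟨j, rfl⟩ : ∃ j, i = j + 1 := ⟨i - 1, by
        have : i ≠ 0 := by rintro rfl; exact hnd (dvd_zero _)
        omega⟩
      have h1 := hrec j
      rw [if_neg (by omega : ¬ j = β), add_zero] at h1
      have hj : (j + 1 : k) ≠ 0 := by exact_mod_cast Nat.succ_ne_zero j
      split_ifs at h1 with hα
      · rw [ih (j - α) (by omega) (by omega) (fun hd => hnd (by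
          have := Nat.dvd_add hd (dvd_refl (α + 1))
          rwa [show j - α + (α + 1) = j + 1 by omega] at this)), mul_zero] at h1
        exact (mul_eq_zero.1 h1).resolve_right hj
      · exact (mul_eq_zero.1 h1).resolve_right hj
  have hp : p ≠ 0 := by
    rintro rfl
    have h1 := hrec β
    simp [hB.symm] at h1
  have hlc : p.coeff p.natDegree ≠ 0 := by
    rw [coeff_natDegree]; exact leadingCoeff_ne_zero.2 hp
  have h1 := hrec (p.natDegree + α)
  rw [coeff_eq_zero_of_natDegree_lt (by omega), zero_mul, if_pos (by omega),
    Nat.add_sub_cancel] at h1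
  split_ifs at h1 with hβ
  · apply hlc
    rw [show p.natDegree = β - α by omega]
    exact hzero _ (by omega) hdvd
  · rw [add_zero] at h1
    exact mul_ne_zero hA hlc h1.symm

/-- If `α + 1 ∣ β - α`, the equation `p' = A x ^ α p + B x ^ β` has a polynomial solution. -/
theorem exists_polynomial_solution {A B : k} (hA : A ≠ 0) {α β : ℕ} (m : ℕ)
    (hm : β = α + m * (α + 1)) :
    ∃ p : k[X], derivative p = C A * X ^ α * p + C B * X ^ β := by
  induction m generalizing B β with
  | zero =>
    refine ⟨C (-(B / A)), ?_⟩
    rw [hm, derivative_C, mul_right_comm, ← C_mul, mul_neg, mul_div_cancel₀ _ hA, zero_mul,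
      add_zero, C_neg]
    ring
  | succ m ih =>
    -- Subtracting `(B/A) x^(β - α)` absorbs the inhomogeneous term and leaves its derivative, of
    -- exponent lower by `α + 1`.
    obtain ⟨p, hp⟩ := ih (B := ((m + 1) * (α + 1) : k) * (B / A)) (β := α + m * (α + 1)) rfl
    refine ⟨p - C (B / A) * X ^ ((m + 1) * (α + 1)), ?_⟩
    have hβ : β = α + (m + 1) * (α + 1) := hm
    have hB : C B = C A * C (B / A) := by rw [← C_mul, mul_div_cancel₀ _ hA]
    rw [derivative_sub, hp, derivative_C_mul_X_pow,
      show (m + 1) * (α + 1) - 1 = α + m * (α + 1) by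
        rw [Nat.add_mul, one_mul]; omega, hβ, hB, pow_add X α ((m + 1) * (α + 1))]
    push_cast
    simp only [C_mul]
    ring

end LinearEquation

/-! ### Darboux polynomials free of `y`, and the linear case. -/

section DarbouxUnit

variable {k : Type*} [Field k] [CharZero k]

theorem isUnit_of_natDegree_eq_zero_of_dvd_planarDeriv {r : ℕ} {g f : k[X][X]} (hf : f ≠ 0)
    (h0 : f.natDegree = 0) (hdvd : f ∣ planarDeriv derivative.toAddMonoidHom r g f) :
    IsUnit f := by
  obtain ⟨c, rfl⟩ : ∃ c, f = C c := ⟨f.coeff 0, eq_C_of_natDegree_eq_zero h0⟩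
  have hc : c ≠ 0 := by rintro rfl; exact hf C_0
  rw [planarDeriv_C, C_dvd_iff_dvd_coeff] at hdvd
  have h1 := hdvd r
  rw [mul_comm, coeff_C_mul_X_pow, if_pos rfl] at h1
  -- `c` divides its derivative, which has smaller degree unless it is zero.
  have h2 : derivative c = 0 := by
    by_contra hne
    exact absurd (natDegree_le_of_dvd h1 hne) (not_le.2 (natDegree_derivative_lt (fun h => hne (by
      rw [eq_C_of_natDegree_eq_zero h, derivative_C]))))
  rw [Polynomial.isUnit_C]
  exact (isUnit_iff_degree_eq_zero.2 (by
    rw [degree_eq_natDegree hc, derivative_eq_zero.1 h2]; rfl))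

theorem natDegree_eq_zero_of_dvd_planarDeriv_linear {α β : ℕ} {A B : k} (hA : A ≠ 0)
    (hB : B ≠ 0) (hαβ : α < β) (hnd : ¬ (α + 1) ∣ (β - α)) {f : k[X][X]} (hf : f ≠ 0)
    (hdvd : f ∣ planarDeriv derivative.toAddMonoidHom 0 (planarBinomial A α 1 B β) f) :
    f.natDegree = 0 := by
  obtain ⟨h1, -⟩ := natDegree_relations_of_dvd_planarDeriv hA hB zero_lt_one hαβ.ne hf hdvd
  -- For `r = 0` and `s = 1` the factor `s - r - 1` vanishes, so the degree relation says just this.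
  have hlc : f.leadingCoeff.natDegree = 0 := by
    have : (f.leadingCoeff.natDegree : ℚ) = 0 := by simpa using h1
    exact_mod_cast this
  obtain ⟨c, hc⟩ : ∃ c, f.leadingCoeff = C c := ⟨_, eq_C_of_natDegree_eq_zero hlc⟩
  have hc0 : c ≠ 0 := by
    rintro rfl
    exact leadingCoeff_ne_zero.2 hf (by rw [hc, C_0])
  by_contra hn
  obtain ⟨n, hn⟩ : ∃ n, f.natDegree = n + 1 := ⟨f.natDegree - 1, by omega⟩
  obtain ⟨l, hl⟩ := hdvd
  have hco : ∀ j, (planarDeriv derivative.toAddMonoidHom 0 (planarBinomial A α 1 B β) f).coeff j =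
      derivative (f.coeff j) + (C A * X ^ α) * (f.coeff j * (j : k[X])) +
        (C B * X ^ β) * (f.coeff (j + 1) * ((j : k[X]) + 1)) := by
    intro j
    rw [planarDeriv, planarBinomial, pow_zero, one_mul, pow_one, coeff_add, coeff_coeffwise,
      add_mul, coeff_add, mul_assoc, coeff_C_mul, coeff_C_mul, coeff_derivative, add_assoc]
    have hX : (X * derivative f).coeff j = f.coeff j * (j : k[X]) := by
      rcases j with _ | j
      · simp
      · rw [coeff_X_mul, coeff_derivative]; push_cast; rfl
    rw [hX]
    rfl
  have htop : f.coeff (n + 1) = C c := by rw [← hn, coeff_natDegree, hc]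
  have hbig : ∀ j, n + 1 < j → f.coeff j = 0 := fun j hj =>
    coeff_eq_zero_of_natDegree_lt (by omega)
  -- With `r = 0` and `s = 1` the derivation does not raise the degree in `y`.
  have hl0 : l.natDegree = 0 := by
    by_contra hne
    have hl1 : l ≠ 0 := by rintro rfl; simp at hne
    have hd := natDegree_mul hf hl1
    have : (f * l).natDegree ≤ n + 1 := by
      rw [natDegree_le_iff_coeff_eq_zero]
      intro j hj
      rw [← hl, hco, hbig j hj, hbig (j + 1) (by omega)]
      simp
    omega
  obtain ⟨m, rfl⟩ : ∃ m, l = C m := ⟨_, eq_C_of_natDegree_eq_zero hl0⟩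
  have e1 := hco (n + 1)
  rw [hl, coeff_mul_C, htop, hbig (n + 1 + 1) (by omega), derivative_C] at e1
  have e2 := hco n
  rw [hl, coeff_mul_C, htop] at e2
  have hCc : (C c : k[X]) ≠ 0 := C_ne_zero.2 hc0
  have hm : m = C A * X ^ α * ((n : k[X]) + 1) := by
    apply mul_left_cancel₀ hCc
    rw [e1]; push_cast; ring
  -- The top coefficient gives the cofactor `(n + 1) A x^α`. The coefficient of `y^n` then makes
  -- `f.coeff n` a solution of the linear equation.
  refine no_polynomial_solution hA (B := -(B * (c * (n + 1)))) ?_ hαβ hnd (f.coeff n) ?_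
  · exact neg_ne_zero.2 (mul_ne_zero hB (mul_ne_zero hc0 (by exact_mod_cast Nat.succ_ne_zero n)))
  · rw [hm] at e2
    simp only [C_neg, C_mul, C_add, C_1, map_natCast]
    linear_combination -e2

end DarbouxUnit

/-! ### From the absence of Darboux polynomials to the absence of invariant ideals. -/

section StableIdeal

variable {k : Type*} [Field k]

theorem Polynomial.IsPrimitive.dvd_of_dvd_C_mul {f h : k[X][X]} (hf : f.IsPrimitive) {c : k[X]}
    (hc : c ≠ 0) (hd : f ∣ C c * h) : f ∣ h := by
  let : NormalizedGCDMonoid k[X] := Classical.choice inferInstance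
  by_cases h0 : h = 0
  · rw [h0]; exact dvd_zero f
  have hne : C c * h ≠ 0 := mul_ne_zero (C_ne_zero.2 hc) h0
  have h1 := ((hf.dvd_primPart_iff_dvd hne).2 hd).trans (associated_primPart_mul hne).dvd
  exact ((isUnit_primPart_C c).dvd_mul_left.1 h1).trans (primPart_dvd h)

/-- Pseudo-division: cancelling leading terms stays in `I` and lowers the degree, at the cost of a
factor from `k[x]`. -/
theorem exists_dvd_C_mul_of_minimal {I : Ideal k[X][X]} {g : k[X][X]} (hgI : g ∈ I) (hg0 : g ≠ 0)
    (hmin : ∀ h ∈ I, h ≠ 0 → g.natDegree ≤ h.natDegree) :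
    ∀ n, ∀ h ∈ I, h.natDegree ≤ n → ∃ c : k[X], c ≠ 0 ∧ g ∣ C c * h := by
  intro n
  induction n with
  | zero =>
    intro h hI hn
    by_cases h0 : h = 0
    · exact ⟨1, one_ne_zero, by rw [h0, mul_zero]; exact dvd_zero g⟩
    have hgd : g.natDegree = 0 := by have := hmin h hI h0; omega
    refine ⟨g.coeff 0, ?_, ?_⟩
    · intro h1
      rw [eq_C_of_natDegree_eq_zero hgd, h1, C_0] at hg0
      exact hg0 rfl
    · rw [← eq_C_of_natDegree_eq_zero hgd]; exact Dvd.intro _ rfl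
  | succ n ih =>
    intro h hI hn
    by_cases h0 : h = 0
    · exact ⟨1, one_ne_zero, by rw [h0, mul_zero]; exact dvd_zero g⟩
    by_cases hn' : h.natDegree ≤ n
    · exact ih h hI hn'
    have hle := hmin h hI h0
    have hlt := natDegree_cancelLeads_lt_of_natDegree_le_natDegree hle (by omega)
    have hmem : g.cancelLeads h ∈ I :=
      sub_mem (Ideal.mul_mem_left _ _ hI) (Ideal.mul_mem_left _ _ hgI)
    obtain ⟨c, hc, hd⟩ := ih _ hmem (by omega)
    refine ⟨c * g.leadingCoeff, mul_ne_zero hc (leadingCoeff_ne_zero.2 hg0), ?_⟩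
    rw [cancelLeads, Nat.sub_eq_zero_of_le hle, pow_zero, mul_one, mul_sub] at hd
    rw [C_mul, mul_assoc]
    exact (dvd_sub_left (Dvd.intro_left _ (by ring :
      C c * (C h.leadingCoeff * X ^ (h.natDegree - g.natDegree)) * g = _))).1 hd

theorem isLeibniz_derivative : IsLeibniz (derivative (R := k)).toAddMonoidHom := fun a b => by
  simp only [LinearMap.toAddMonoidHom_coe, derivative_mul]; ring

/-- Without Darboux polynomials, a nonzero stable ideal meets `k[x]`. -/
theorem exists_C_mem_of_stable {r : ℕ} {g : k[X][X]}
    (hD : ∀ f : k[X][X], f ≠ 0 → f ∣ planarDeriv derivative.toAddMonoidHom r g f → IsUnit f)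
    {I : Ideal k[X][X]} (hI : ∀ a ∈ I, planarDeriv derivative.toAddMonoidHom r g a ∈ I)
    (h0 : I ≠ ⊥) : ∃ c : k[X], c ≠ 0 ∧ C c ∈ I := by
  classical
  let : NormalizedGCDMonoid k[X] := Classical.choice inferInstance
  have hex : ∃ n, ∃ a ∈ I, a ≠ 0 ∧ a.natDegree = n := by
    obtain ⟨a, ha, ha0⟩ := Submodule.exists_mem_ne_zero_of_ne_bot h0
    exact ⟨_, a, ha, ha0, rfl⟩
  obtain ⟨p, hpI, hp0, hpd⟩ := Nat.find_spec hex
  have hmin : ∀ h ∈ I, h ≠ 0 → p.natDegree ≤ h.natDegree := by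
    intro h hh h0
    rw [hpd]
    exact Nat.find_min' hex ⟨h, hh, h0, rfl⟩
  set f := p.primPart with hf
  have hfp : f.IsPrimitive := isPrimitive_primPart p
  have hcont : p = C p.content * f := eq_C_content_mul_primPart p
  have hc0 : p.content ≠ 0 := by rwa [Ne, content_eq_zero_iff]
  have hdiv : ∀ h ∈ I, f ∣ h := by
    intro h hh
    obtain ⟨c, hc, hd⟩ := exists_dvd_C_mul_of_minimal hpI hp0 hmin _ h hh le_rfl
    exact hfp.dvd_of_dvd_C_mul hc ((primPart_dvd p).trans hd)
  -- Modulo `f`, the derivative of `content * f` is `content * d f`, and by primitivity the content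
  -- can be cancelled.
  have hfd : f ∣ planarDeriv derivative.toAddMonoidHom r g f := by
    have h1 := hdiv _ (hI p hpI)
    rw [hcont, planarDeriv_mul isLeibniz_derivative] at h1
    exact hfp.dvd_of_dvd_C_mul hc0 ((dvd_add_left (Dvd.intro _ rfl)).1 h1)
  obtain ⟨u, hu⟩ := hD f (primPart_ne_zero p) hfd
  refine ⟨p.content, hc0, ?_⟩
  have : C p.content = ((u⁻¹ : (k[X][X])ˣ) : k[X][X]) * p := by
    conv_rhs => rw [hcont, ← hu]
    rw [mul_left_comm, Units.inv_mul, mul_one]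
  rw [this]
  exact Ideal.mul_mem_left _ _ hpI

theorem Ideal.eq_top_of_C_C_mem {I : Ideal k[X][X]} {b : k} (hb : b ≠ 0) (h : C (C b) ∈ I) :
    I = ⊤ :=
  Ideal.eq_top_of_isUnit_mem I h (by
    rw [Polynomial.isUnit_C, Polynomial.isUnit_C]; exact hb.isUnit)

variable [CharZero k]

theorem eq_top_of_stable_of_eq_zero {g : k[X][X]} {I : Ideal k[X][X]}
    (hI : ∀ a ∈ I, planarDeriv derivative.toAddMonoidHom 0 g a ∈ I) :
    ∀ n, ∀ c : k[X], c.natDegree ≤ n → c ≠ 0 → C c ∈ I → I = ⊤ := by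
  intro n
  induction n with
  | zero =>
    intro c hc hc0 hcI
    rw [eq_C_of_natDegree_le_zero hc] at hc0 hcI
    exact Ideal.eq_top_of_C_C_mem (C_ne_zero.1 hc0) hcI
  | succ n ih =>
    intro c hc hc0 hcI
    by_cases h : c.natDegree ≤ n
    · exact ih c h hc0 hcI
    have h1 := hI _ hcI
    rw [planarDeriv_C, pow_zero, one_mul] at h1
    have hd : c.natDegree ≠ 0 := by omega
    refine ih (derivative c) ?_ (fun h2 => hd (derivative_eq_zero.1 h2)) h1
    have := natDegree_derivative_lt hd
    omega

theorem X_pow_mem_of_stable {r : ℕ} {g : k[X][X]} {I : Ideal k[X][X]}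
    (hI : ∀ a ∈ I, planarDeriv derivative.toAddMonoidHom r g a ∈ I) :
    ∀ n, ∀ c : k[X], ∀ N, c.natDegree ≤ n → c ≠ 0 → X ^ (N + 1) * C c ∈ I →
      ∃ M, (X : k[X][X]) ^ M ∈ I := by
  intro n
  induction n with
  | zero =>
    intro c N hc hc0 hcI
    rw [eq_C_of_natDegree_le_zero hc] at hc0 hcI
    have hb := C_ne_zero.1 hc0
    refine ⟨N + 1, ?_⟩
    have h1 := Ideal.mul_mem_right (C (C (c.coeff 0)⁻¹)) I hcI
    rwa [mul_assoc, ← C_mul, ← C_mul, mul_inv_cancel₀ hb, C_1, C_1, mul_one] at h1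
  | succ n ih =>
    intro c N hc hc0 hcI
    by_cases h : c.natDegree ≤ n
    · exact ih c N h hc0 hcI
    have hd : c.natDegree ≠ 0 := by omega
    have h1 := hI _ hcI
    rw [planarDeriv_mul isLeibniz_derivative, planarDeriv_pow_succ isLeibniz_derivative,
      planarDeriv_X isLeibniz_derivative, planarDeriv_C] at h1
    have h2 := Ideal.mul_mem_left I X h1
    -- In `y * d(y^(N+1) c)` the part coming from `d y = g` is a multiple of `y^(N+1) c`. Removing
    -- it leaves `y^(N+2+r) c'`.
    have h3 := Ideal.mul_mem_left I (((N : k[X][X]) + 1) * g) hcI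
    have h4 := sub_mem h2 h3
    refine ih (derivative c) (N + 1 + r) ?_
      (fun h2 => hd (derivative_eq_zero.1 h2)) ?_
    · have := natDegree_derivative_lt hd
      omega
    · convert h4 using 1
      simp only [LinearMap.toAddMonoidHom_coe]
      ring

theorem eq_top_of_stable_of_X_pow_mem {r α s : ℕ} {A B : k} (hB : B ≠ 0) (hs : 0 < s)
    {I : Ideal k[X][X]}
    (hI : ∀ a ∈ I, planarDeriv derivative.toAddMonoidHom r (planarBinomial A α s B 0) a ∈ I)
    (M : ℕ) (hM : (X : k[X][X]) ^ M ∈ I) : I = ⊤ := by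
  induction M with
  | zero => rwa [pow_zero, ← Ideal.eq_top_iff_one] at hM
  | succ M ih =>
    apply ih
    obtain ⟨s, rfl⟩ : ∃ s', s = s' + 1 := ⟨s - 1, by omega⟩
    have h1 := hI _ hM
    rw [planarDeriv_pow_succ isLeibniz_derivative, planarDeriv_X isLeibniz_derivative] at h1
    -- As `s > 0`, the first term of `d(y^(M+1)) = (M+1) y^M (A x^α y^s + B)` is a multiple of
    -- `y^(M+1)`. What remains is `y^M` times a nonzero constant.
    have h2 := Ideal.mul_mem_left I (((M : k[X][X]) + 1) * C (C A * X ^ α) * X ^ s) hM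
    have h3 := sub_mem h1 h2
    have hb : ((M + 1 : k) * B) ≠ 0 := mul_ne_zero (by exact_mod_cast Nat.succ_ne_zero M) hB
    have h4 := Ideal.mul_mem_right (C (C ((M + 1 : k) * B)⁻¹)) I h3
    have e : ((M : k[X][X]) + 1) = C (C (M + 1 : k)) := by simp
    have e2 : C (C ((M + 1 : k) * B)) * C (C ((M + 1 : k) * B)⁻¹) = (1 : k[X][X]) := by
      rw [← C_mul, ← C_mul, mul_inv_cancel₀ hb, C_1, C_1]
    convert h4 using 1
    rw [planarBinomial, pow_zero, mul_one, e]
    rw [show C (C (M + 1 : k)) * X ^ M * (C (C A * X ^ α) * X ^ (s + 1) + C (C B)) -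
      C (C (M + 1 : k)) * C (C A * X ^ α) * X ^ s * X ^ (M + 1) =
      X ^ M * C (C ((M + 1 : k) * B)) by simp only [C_mul]; ring, mul_assoc, e2, mul_one]

end StableIdeal

end PlanarDerivations

/-! ### Necessity: explicit invariant ideals. -/

section NotSimple

open MvPolynomial

variable {k : Type*} [Field k]

theorem binomialDerivation_apply (r t₁ s₁ t₂ s₂ : ℕ) (c₁ c₂ : k) (f : MvPolynomial (Fin 2) k) :
    binomialDerivation r t₁ s₁ t₂ s₂ c₁ c₂ f = X 1 ^ r * pderiv 0 f +
      (C c₁ * X 0 ^ t₁ * X 1 ^ s₁ + C c₂ * X 0 ^ t₂ * X 1 ^ s₂) * pderiv 1 f := rfl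

theorem binomialDerivation_X_zero (r t₁ s₁ t₂ s₂ : ℕ) (c₁ c₂ : k) :
    binomialDerivation r t₁ s₁ t₂ s₂ c₁ c₂ (X 0) = X 1 ^ r := by
  rw [binomialDerivation_apply, pderiv_X_self, pderiv_X_of_ne (by decide), mul_one, mul_zero,
    add_zero]

theorem binomialDerivation_X_one (r t₁ s₁ t₂ s₂ : ℕ) (c₁ c₂ : k) :
    binomialDerivation r t₁ s₁ t₂ s₂ c₁ c₂ (X 1) =
      C c₁ * X 0 ^ t₁ * X 1 ^ s₁ + C c₂ * X 0 ^ t₂ * X 1 ^ s₂ := by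
  rw [binomialDerivation_apply, pderiv_X_self, pderiv_X_of_ne (by decide), mul_one, mul_zero,
    zero_add]

/-- A Darboux polynomial which is nonconstant on the line `x = 0` obstructs simplicity. -/
theorem not_isSimpleDerivation_of_dvd
    {d : Derivation k (MvPolynomial (Fin 2) k) (MvPolynomial (Fin 2) k)}
    {f : MvPolynomial (Fin 2) k}
    (hf : 0 < (aeval ![(0 : Polynomial k), Polynomial.X] f).natDegree) (hd : f ∣ d f) :
    ¬ IsSimpleDerivation d := by
  intro h
  have hI : IsDifferentialIdeal d (Ideal.span {f}) := by
    intro a ha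
    obtain ⟨b, rfl⟩ := Ideal.mem_span_singleton.1 ha
    rw [Ideal.mem_span_singleton, Derivation.leibniz, smul_eq_mul, smul_eq_mul]
    exact dvd_add (Dvd.intro _ rfl) (hd.mul_left b)
  rcases (h _).1 hI with h0 | h0
  · rw [Ideal.span_singleton_eq_bot] at h0
    simp [h0] at hf
  · rw [Ideal.span_singleton_eq_top] at h0
    rw [Polynomial.natDegree_eq_zero_of_isUnit (h0.map _)] at hf
    exact lt_irrefl _ hf

/-- The line `y = 0` is invariant. -/
theorem not_isSimpleDerivation_of_X_dvd {r t₁ s₁ t₂ s₂ : ℕ} {c₁ c₂ : k}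
    (h₁ : c₁ = 0 ∨ 0 < s₁) (h₂ : c₂ = 0 ∨ 0 < s₂) :
    ¬ IsSimpleDerivation (binomialDerivation r t₁ s₁ t₂ s₂ c₁ c₂) := by
  have key : ∀ (c : k) (t s : ℕ), (c = 0 ∨ 0 < s) →
      (X 1 : MvPolynomial (Fin 2) k) ∣ C c * X 0 ^ t * X 1 ^ s := by
    rintro c t s (rfl | hs)
    · simp
    · exact (dvd_pow_self _ hs.ne').mul_left _
  refine not_isSimpleDerivation_of_dvd (f := X 1) (by simp) ?_
  rw [binomialDerivation_X_one]
  exact dvd_add (key _ _ _ h₁) (key _ _ _ h₂)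

/-- With separated variables there is a polynomial first integral. -/
theorem not_isSimpleDerivation_of_separated [CharZero k] {r t₁ s₁ t₂ s₂ : ℕ} {c₁ c₂ : k}
    (h₁ : c₁ = 0 ∨ s₁ = 0) (h₂ : c₂ = 0 ∨ s₂ = 0) :
    ¬ IsSimpleDerivation (binomialDerivation r t₁ s₁ t₂ s₂ c₁ c₂) := by
  have key : ∀ (c : k) (t s : ℕ), (c = 0 ∨ s = 0) →
      (C c * X 0 ^ t * X 1 ^ s : MvPolynomial (Fin 2) k) = C c * X 0 ^ t := by
    rintro c t s (rfl | rfl) <;> simp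
  have cast : ∀ (c : k) (n : ℕ), (C c : MvPolynomial (Fin 2) k) =
      C (c / ((n + 1 : ℕ) : k)) * ((n + 1 : ℕ) : MvPolynomial (Fin 2) k) := by
    intro c n
    rw [← map_natCast (C : k →+* MvPolynomial (Fin 2) k), ← C_mul,
      div_mul_cancel₀ _ (by exact_mod_cast Nat.succ_ne_zero n)]
  refine not_isSimpleDerivation_of_dvd
    (f := C (1 / ((r + 1 : ℕ) : k)) * X 1 ^ (r + 1) - C (c₁ / ((t₁ + 1 : ℕ) : k)) * X 0 ^ (t₁ + 1) -
      C (c₂ / ((t₂ + 1 : ℕ) : k)) * X 0 ^ (t₂ + 1)) ?_ ?_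
  · have hr : (1 / ((r + 1 : ℕ) : k)) ≠ 0 :=
      one_div_ne_zero (by exact_mod_cast Nat.succ_ne_zero r)
    have : aeval ![(0 : Polynomial k), Polynomial.X] (C (1 / ((r + 1 : ℕ) : k)) * X 1 ^ (r + 1) -
        C (c₁ / ((t₁ + 1 : ℕ) : k)) * X 0 ^ (t₁ + 1) -
        C (c₂ / ((t₂ + 1 : ℕ) : k)) * X 0 ^ (t₂ + 1)) =
        Polynomial.C (1 / ((r + 1 : ℕ) : k)) * Polynomial.X ^ (r + 1) := by
      simp only [map_sub, map_mul, map_pow, aeval_X, algHom_C, Polynomial.algebraMap_eq,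
        Matrix.cons_val_zero, Matrix.cons_val_one, zero_pow (Nat.succ_ne_zero _), mul_zero,
        sub_zero]
    rw [this, Polynomial.natDegree_C_mul_X_pow _ _ hr]
    omega
  · have h0 : ∀ a : k, binomialDerivation r t₁ s₁ t₂ s₂ c₁ c₂ (C a) = 0 := fun a =>
      Derivation.map_algebraMap _ a
    have : binomialDerivation r t₁ s₁ t₂ s₂ c₁ c₂ (C (1 / ((r + 1 : ℕ) : k)) * X 1 ^ (r + 1) -
        C (c₁ / ((t₁ + 1 : ℕ) : k)) * X 0 ^ (t₁ + 1) -
        C (c₂ / ((t₂ + 1 : ℕ) : k)) * X 0 ^ (t₂ + 1)) = 0 := by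
      simp only [map_sub, Derivation.leibniz, Derivation.leibniz_pow, h0,
        binomialDerivation_X_zero, binomialDerivation_X_one, Nat.add_sub_cancel, smul_eq_mul,
        key _ _ _ h₁, key _ _ _ h₂, nsmul_eq_mul]
      have e0 := cast 1 r
      have e1 := cast c₁ t₁
      have e2 := cast c₂ t₂
      rw [C_1] at e0
      linear_combination (X 1 ^ r * (X 0 ^ t₂ * C c₂ + C c₁ * X 0 ^ t₁)) * (-e0) +
        X 1 ^ r * X 0 ^ t₁ * e1 + X 1 ^ r * X 0 ^ t₂ * e2
    rw [this]
    exact dvd_zero _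

/-- If both monomials have the same degree in `x`, their common `y`-factor is invariant. -/
theorem not_isSimpleDerivation_of_eq {r t s₁ s₂ : ℕ} {c₁ c₂ : k} (hc₁ : c₁ ≠ 0) (hc₂ : c₂ ≠ 0)
    (hs : s₁ ≠ s₂) : ¬ IsSimpleDerivation (binomialDerivation r t s₁ t s₂ c₁ c₂) := by
  set p : Polynomial k :=
    Polynomial.C c₁ * Polynomial.X ^ s₁ + Polynomial.C c₂ * Polynomial.X ^ s₂ with hp
  refine not_isSimpleDerivation_of_dvd
    (f := Polynomial.aeval (X 1 : MvPolynomial (Fin 2) k) p) ?_ ?_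
  · have : aeval ![(0 : Polynomial k), Polynomial.X]
        (Polynomial.aeval (X 1 : MvPolynomial (Fin 2) k) p) = p := by
      rw [← Polynomial.aeval_algHom_apply, aeval_X]
      simp
    rw [this]
    have hco : ∀ n, p.coeff n = (if n = s₁ then c₁ else 0) + if n = s₂ then c₂ else 0 := by
      intro n
      simp [hp, Polynomial.coeff_X_pow]
    rcases Nat.lt_or_ge 0 s₁ with h | h
    · refine h.trans_le (Polynomial.le_natDegree_of_ne_zero ?_)
      rw [hco, if_pos rfl, if_neg hs, add_zero]
      exact hc₁
    · refine (show 0 < s₂ by omega).trans_le (Polynomial.le_natDegree_of_ne_zero ?_)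
      rw [hco, if_pos rfl, if_neg hs.symm, zero_add]
      exact hc₂
  · rw [Derivation.map_aeval, binomialDerivation_X_one, smul_eq_mul]
    refine Dvd.dvd.mul_left ⟨X 0 ^ t, ?_⟩ _
    simp only [hp, map_add, map_mul, map_pow, Polynomial.aeval_X, Polynomial.aeval_C,
      algebraMap_eq]
    ring

/-- The origin is a singular point. -/
theorem not_isSimpleDerivation_of_singular {r t₁ s₁ t₂ s₂ : ℕ} {c₁ c₂ : k} (hr : 0 < r)
    (h₁ : 0 < t₁ + s₁) (h₂ : 0 < t₂ + s₂) :
    ¬ IsSimpleDerivation (binomialDerivation r t₁ s₁ t₂ s₂ c₁ c₂) := by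
  intro h
  have key : ∀ (c : k) (t s : ℕ), 0 < t + s →
      constantCoeff (C c * X 0 ^ t * X 1 ^ s : MvPolynomial (Fin 2) k) = 0 := by
    intro c t s hts
    rcases Nat.lt_or_ge 0 t with ht | ht
    · simp [ht.ne']
    · simp [(show s ≠ 0 by omega)]
  have hI : IsDifferentialIdeal (binomialDerivation r t₁ s₁ t₂ s₂ c₁ c₂)
      (RingHom.ker (constantCoeff (σ := Fin 2) (R := k))) := by
    intro a _
    rw [RingHom.mem_ker, binomialDerivation_apply, map_add, map_mul, map_mul, map_add,
      key _ _ _ h₁, key _ _ _ h₂, map_pow, constantCoeff_X, zero_pow hr.ne']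
    simp
  rcases (h _).1 hI with h0 | h0
  · have : (X 0 : MvPolynomial (Fin 2) k) ∈ RingHom.ker (constantCoeff (σ := Fin 2) (R := k)) :=
      constantCoeff_X k 0
    rw [h0, Ideal.mem_bot] at this
    exact X_ne_zero 0 this
  · exact RingHom.ker_ne_top _ h0

/-- A polynomial solution of the linear equation gives an invariant graph. -/
theorem not_isSimpleDerivation_of_linear {t₁ t₂ : ℕ} {c₁ c₂ : k} (hc₂ : c₂ ≠ 0) (ht : t₂ ≤ t₁)
    (hd : (t₂ + 1) ∣ (t₁ - t₂)) :
    ¬ IsSimpleDerivation (binomialDerivation 0 t₁ 0 t₂ 1 c₁ c₂) := by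
  obtain ⟨m, hm⟩ := hd
  obtain ⟨p, hp⟩ := exists_polynomial_solution (B := c₁) hc₂ (α := t₂) (β := t₁) m (by
    rw [mul_comm]; omega)
  refine not_isSimpleDerivation_of_dvd (f := X 1 - Polynomial.aeval (X 0) p) ?_ ?_
  · have : aeval ![(0 : Polynomial k), Polynomial.X]
        (X 1 - Polynomial.aeval (X 0 : MvPolynomial (Fin 2) k) p) =
        Polynomial.X - Polynomial.C (p.coeff 0) := by
      rw [map_sub, ← Polynomial.aeval_algHom_apply, aeval_X, aeval_X]
      simp [← Polynomial.coeff_zero_eq_aeval_zero']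
    rw [this, Polynomial.natDegree_X_sub_C]
    exact one_pos
  · rw [map_sub, Derivation.map_aeval, binomialDerivation_X_one, binomialDerivation_X_zero, hp]
    refine ⟨C c₂ * X 0 ^ t₂, ?_⟩
    simp only [map_add, map_mul, map_pow, Polynomial.aeval_X, Polynomial.aeval_C,
      algebraMap_eq, pow_zero, pow_one, smul_eq_mul, mul_one]
    ring

end NotSimple

/-! ### Sufficiency, and the equivalence. -/

section Simple

open Polynomial Polynomial.Bivariate

variable {k : Type*} [Field k]

theorem binomialDerivation_equivMvPolynomial (r t₁ s₁ t₂ s₂ : ℕ) (c₁ c₂ : k) (f : k[X][X]) :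
    binomialDerivation r t₁ s₁ t₂ s₂ c₁ c₂ (equivMvPolynomial k f) =
      equivMvPolynomial k (planarDeriv derivative.toAddMonoidHom r
        (C (C c₁ * X ^ t₁) * X ^ s₁ + C (C c₂ * X ^ t₂) * X ^ s₂) f) := by
  have h : PolynomialModule.equivPolynomialSelf (derivative'.mapCoeffs f) =
      coeffwise (derivative (R := k)).toAddMonoidHom f := by
    ext1 n
    rw [coeff_coeffwise]
    rfl
  rw [binomialDerivation_apply, pderiv_zero_equivMvPolynomial, pderiv_one_equivMvPolynomial, h,
    planarDeriv]
  simp only [map_add, map_mul, map_pow, equivMvPolynomial_C_C, equivMvPolynomial_C_X,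
    equivMvPolynomial_X]

theorem isSimpleDerivation_of_planarDeriv {r t₁ s₁ t₂ s₂ : ℕ} {c₁ c₂ : k}
    (h : ∀ I : Ideal k[X][X], (∀ a ∈ I, planarDeriv derivative.toAddMonoidHom r
      (C (C c₁ * X ^ t₁) * X ^ s₁ + C (C c₂ * X ^ t₂) * X ^ s₂) a ∈ I) → I ≠ ⊥ → I = ⊤) :
    IsSimpleDerivation (binomialDerivation r t₁ s₁ t₂ s₂ c₁ c₂) := by
  intro I
  constructor
  · intro hI
    by_contra! hne
    have h1 := h (I.comap (equivMvPolynomial k)) (fun a ha => by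
      rw [Ideal.mem_comap] at ha ⊢
      rw [← binomialDerivation_equivMvPolynomial]
      exact hI _ ha) (fun h0 => hne.1 (by
      rw [eq_bot_iff]
      intro a ha
      have : (equivMvPolynomial k).symm a ∈ I.comap (equivMvPolynomial k) := by
        rw [Ideal.mem_comap, AlgEquiv.apply_symm_apply]; exact ha
      rw [h0, Ideal.mem_bot, map_eq_zero_iff _ (equivMvPolynomial k).symm.injective] at this
      exact this))
    rw [Ideal.eq_top_iff_one, Ideal.mem_comap, map_one, ← Ideal.eq_top_iff_one] at h1
    exact hne.2 h1
  · rintro (rfl | rfl) a ha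
    · rw [Ideal.mem_bot] at ha ⊢
      rw [ha, map_zero]
    · exact Submodule.mem_top

variable [CharZero k]

theorem eq_top_of_stable_planarBinomial_of_zero {α s β : ℕ} {A B : k}
    (hdeg : ∀ f : k[X][X], f ≠ 0 →
      f ∣ planarDeriv derivative.toAddMonoidHom 0 (planarBinomial A α s B β) f → f.natDegree = 0)
    (I : Ideal k[X][X])
    (hI : ∀ a ∈ I, planarDeriv derivative.toAddMonoidHom 0 (planarBinomial A α s B β) a ∈ I)
    (h0 : I ≠ ⊥) : I = ⊤ := by
  obtain ⟨c, hc, hcI⟩ := exists_C_mem_of_stable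
    (fun f hf hd => isUnit_of_natDegree_eq_zero_of_dvd_planarDeriv hf (hdeg f hf hd) hd) hI h0
  exact eq_top_of_stable_of_eq_zero hI _ c le_rfl hc hcI

theorem eq_top_of_stable_planarBinomial_of_pos {r α s : ℕ} {A B : k} (hA : A ≠ 0) (hB : B ≠ 0)
    (hs : 0 < s) (hα : 0 < α) (I : Ideal k[X][X])
    (hI : ∀ a ∈ I, planarDeriv derivative.toAddMonoidHom r (planarBinomial A α s B 0) a ∈ I)
    (h0 : I ≠ ⊥) : I = ⊤ := by
  obtain ⟨c, hc, hcI⟩ := exists_C_mem_of_stable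
    (fun f hf hd => isUnit_of_natDegree_eq_zero_of_dvd_planarDeriv hf (by
      rcases Nat.lt_or_ge r s with hrs | hrs
      · exact natDegree_eq_zero_of_dvd_planarDeriv_of_lt hA hB hrs (Or.inl hα) hf hd
      · exact natDegree_eq_zero_of_dvd_planarDeriv_of_le hA hB hs hrs hα hf hd) hd) hI h0
  obtain ⟨M, hM⟩ := X_pow_mem_of_stable hI _ c 0 le_rfl hc (Ideal.mul_mem_left _ _ hcI)
  exact eq_top_of_stable_of_X_pow_mem hB hs hI M hM

end Simple

theorem theorem5p1 {k : Type*} [Field k] [CharZero k] (r t₁ s₁ t₂ s₂ : ℕ) (c₁ c₂ : k)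
    (ht : t₂ ≤ t₁) (hne : (t₁, s₁) ≠ (t₂, s₂)) :
    IsSimpleDerivation (binomialDerivation r t₁ s₁ t₂ s₂ c₁ c₂) ↔
      (c₁ ≠ 0 ∧ c₂ ≠ 0 ∧ t₂ < t₁) ∧
      (0 < r → t₂ = 0 ∧ s₂ = 0 ∧ 0 < s₁) ∧
      (r = 0 → 0 < s₁ + s₂ ∧ s₁ * s₂ = 0) ∧
      (r = 0 ∧ s₁ = 0 ∧ s₂ = 1 → ¬ (t₂ + 1) ∣ (t₁ - t₂)) := by
  constructor
  · intro h
    have hY : ¬ ((c₁ = 0 ∨ 0 < s₁) ∧ (c₂ = 0 ∨ 0 < s₂)) := fun h' =>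
      not_isSimpleDerivation_of_X_dvd h'.1 h'.2 h
    have hS : ¬ ((c₁ = 0 ∨ s₁ = 0) ∧ (c₂ = 0 ∨ s₂ = 0)) := fun h' =>
      not_isSimpleDerivation_of_separated h'.1 h'.2 h
    have hc₁ : c₁ ≠ 0 := fun hc => by
      rcases Nat.eq_zero_or_pos s₂ with hs | hs
      · exact hS ⟨Or.inl hc, Or.inr hs⟩
      · exact hY ⟨Or.inl hc, Or.inr hs⟩
    have hc₂ : c₂ ≠ 0 := fun hc => by
      rcases Nat.eq_zero_or_pos s₁ with hs | hs
      · exact hS ⟨Or.inr hs, Or.inl hc⟩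
      · exact hY ⟨Or.inr hs, Or.inl hc⟩
    -- With both coefficients nonzero, `hY` and `hS` say that exactly one of `s₁`, `s₂` is positive.
    simp only [hc₁, hc₂, false_or] at hY hS
    have hlt : t₂ < t₁ := by
      refine lt_of_le_of_ne ht fun he => ?_
      subst he
      exact not_isSimpleDerivation_of_eq hc₁ hc₂ (fun hs => hne (by rw [hs])) h
    refine ⟨⟨hc₁, hc₂, hlt⟩, fun hr => ?_, fun _ => ⟨by omega, ?_⟩, ?_⟩
    · have h1 : ¬ 0 < t₂ + s₂ := fun h2 =>
        not_isSimpleDerivation_of_singular hr (by omega) h2 h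
      omega
    · rw [mul_eq_zero]; omega
    · rintro ⟨rfl, rfl, rfl⟩ hd
      exact not_isSimpleDerivation_of_linear hc₂ ht hd h
  · rintro ⟨⟨hc₁, hc₂, hlt⟩, hb, hc, hd⟩
    apply isSimpleDerivation_of_planarDeriv
    rcases Nat.eq_zero_or_pos r with rfl | hr
    · obtain ⟨hs, hs'⟩ := hc rfl
      rcases Nat.eq_zero_or_pos s₁ with rfl | hs₁
      -- The second monomial now carries `y`, so the roles are exchanged: `α = t₂ < β = t₁`.
      · rw [pow_zero, mul_one, add_comm]
        refine eq_top_of_stable_planarBinomial_of_zero fun f hf hdvd => ?_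
        rcases (show s₂ = 1 ∨ 1 < s₂ by omega) with rfl | hs₂
        · exact natDegree_eq_zero_of_dvd_planarDeriv_linear hc₂ hc₁ hlt (hd ⟨rfl, rfl, rfl⟩) hf hdvd
        · exact natDegree_eq_zero_of_dvd_planarDeriv_of_lt hc₂ hc₁ (by omega)
            (Or.inr ⟨hlt, by omega⟩) hf hdvd
      · obtain rfl : s₂ = 0 := (mul_eq_zero.1 hs').resolve_left hs₁.ne'
        rw [pow_zero, mul_one]
        exact eq_top_of_stable_planarBinomial_of_zero fun f hf hdvd =>
          natDegree_eq_zero_of_dvd_planarDeriv_of_lt hc₁ hc₂ hs₁ (Or.inl hlt) hf hdvd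
    · obtain ⟨rfl, rfl, hs₁⟩ := hb hr
      rw [pow_zero (Polynomial.X : Polynomial (Polynomial k)), mul_one]
      exact eq_top_of_stable_planarBinomial_of_pos hc₁ hc₂ hs₁ hlt
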